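/- Setting. Let \(m,p,n,n',N\in\mathbb N\) with \(N\ge m+1\), \(T>0\), \(\alpha\in(0,1]\), \(C_\phi\ge0\), and let \(\phi:\mathbb R^m\to\mathbb R^p\) satisfy \(\|\phi(a)-\phi(b)\|\le C_\phi\|a-b\|^\alpha\). Let \(\theta\in\mathbb R^p\) and let \(y:[0,T]\to\mathbb R\) be \(m+1\) times differentiable with \(y^{(m)}(t)=\theta^{\mathsf T}\phi\big(y(t),\dots,y^{(m-1)}(t)\big)\) on \([0,T]\). One observes \(z_j=y(jT/n)+w(jT/n)\), \(1\le j\le n\), where the random variables \(w(t)\) satisfy \(\mathbb E\,w(t)^2<\infty\). Differentiation filter. Take \(n'\) windows \(\{n_i+1,\dots,n_i+N\}\subseteq\{1,\dots,n\}\), put \(t_i=n_iT/n\) and \(x_i=(y(t_i),\dots,y^{(m)}(t_i))\in\mathbb R^{m+1}\). Fix \(\rho:[0,1]\to(0,\infty)\) and polynomials \(p^d\), \(0\le d\le N-1\), with \(\deg p^d=d\), orthogonal for \(\langle f,g\rangle_N=\frac1N\sum_{j=1}^N\rho(\tfrac jN)f(\tfrac jN)g(\tfrac jN)\). With \(h^d=\frac1N\sum_{j=1}^N\rho(\tfrac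 jN)p^d(\tfrac jN)(\tfrac jN)^d\) and \(g^d=\frac1N\sum_{j=1}^N\rho(\tfrac jN)|p^d(\tfrac jN)|\), let \[\hat x_i^d=\frac{d!\,n^d}{N^{d+1}T^dh^d}\sum_{j=1}^N\rho(\tfrac jN)\,p^d(\tfrac jN)\,z_{n_i+j},\qquad 0\le d\le m,\qquad \Delta x_i=\hat x_i-x_i .\] Put \(\tilde A=\sum_{i=1}^{n'}\sum_{d=0}^m\Big(\frac{M_i^dT}{d+1}\cdot\frac{g^d}{h^d}\Big)^2\) with \(M_i^d=\sup_{t_i\le t\le t_i+NT/n}|y^{(d+1)}(t)|\), and \(\tilde B=\sum_{i=1}^{n'}\sum_{d=0}^m\Big(\frac{d!}{T^dh^d}\Big)^2\frac1N\sum_{j=1}^N\rho(\tfrac jN)^2p^d(\tfrac jN)^2\operatorname{Var}w\big(\tfrac{(n_i+j)T}{n}\big)\). Estimator. Let \(P\) be the projection onto the first \(m\) coordinates, let \(\Phi,\hat\Phi\in\mathbb R^{n'\times p}\) have rows \(\phi(Px_i)^{\mathsf T}\) and \(\phi(P\hat x_i)^{\mathsf T}\), let \(u=(0_p,x_1^m,\dots,x_{n'}^m)\)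 and \(\hat u=(0_p,\hat x_1^m,\dots,\hat x_{n'}^m)\). For \(\lambda>0\) let \(\hat\theta=\begin{pmatrix}\lambda I_p\\ \hat\Phi\end{pmatrix}^{\dagger}\hat u\) (Moore–Penrose pseudoinverse). Let \(\sigma_{\min}(\Phi)\) be the smallest of the \(p\) singular values of \(\Phi\), and let \(\bar\sigma=(n')^{-1/2}\sigma_{\min}(\Phi)\), \(\bar U=(n')^{-1/2}\|u\|\). Theorem (First moment of \(\Delta\theta=\hat\theta-\theta\)). (a) Values of \(\epsilon_N\). If \(y^{(m+1)}\) is bounded on \([0,T]\) and the noise values \(w(jT/n)\), \(1\le j\le n\), have mean zero and are pairwise uncorrelated, then \[\mathbb E\sum_{i=1}^{n'}\|\Delta x_i\|^2\le\tilde A\,\frac{N^2}{n^2}+\tilde B\,\frac{n^{2m}}{N^{2m+1}} .\] If moreover \(N=\Big[\frac{(2m+1)\tilde B}{2\tilde A}\Big]^{\frac1{2m+3}}n^{\frac{2m+2}{2m+3}}\), then \(\mathbb E\sum_{i}\|\Delta x_i\|^2\le\epsilon_N\,n'\,n^{-\frac2{2m+3}}\) with \(\epsilon_N=2(2m+1)^{\frac1{2m+3}}\tilde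 A^{\frac{2m+1}{2m+3}}\tilde B^{\frac2{2m+3}}(n')^{-1}\). (b) Moment bound. Let \(\epsilon_N,\epsilon_{N,m}\) be any constants with \[\mathbb E\sum_{i=1}^{n'}\|\Delta x_i\|^2\le\epsilon_N\,n'\,n^{-\frac2{2m+3}},\qquad \mathbb E\sum_{i=1}^{n'}|\Delta x_i^m|^2\le\epsilon_{N,m}\,n'\,n^{-\frac2{2m+3}} .\] Then for every \(\lambda\in(0,\sigma_{\min}(\Phi))\) the random variable \(\|\Delta\theta\|\) is integrable and \[\begin{aligned}\mathbb E\|\Delta\theta\|\le{}&\frac{\epsilon_{N,m}^{1/2}}{\bar\sigma\,n^{\frac1{2m+3}}}+\frac{4\bar U\lambda}{\bar\sigma^2\sqrt{n'}}+\frac{6C_\phi^{2}\,\bar U\,\epsilon_N^{\alpha}}{n^{\frac{2\alpha}{2m+3}}}\left[\frac{2\log(\bar\sigma\sqrt{n'}/\lambda)}{\bar\sigma^3}+\frac{\sqrt{n'}}{\lambda\bar\sigma^2}\right]+\frac{4C_\phi^{2/\alpha}\,\bar U\,\epsilon_N\sqrt{n'}}{\lambda\,\bar\sigma^{2/\alpha}\,n^{\frac2{2m+3}}}\\&+\frac{2^{2-\frac\alpha2}\,\epsilon_{N,m}^{1/2}}{n^{\frac1{2m+3}}}\left(\frac{C_\phi^{2/\alpha}\,\epsilon_N\,(n')^{1/\alpha}}{\lambda^{2/\alpha}\,\bar\sigma^{2/\alpha}\,n^{\frac2{2m+3}}}+\frac1{\bar\sigma^{2/\alpha}}\right)^{\alpha/2}.\end{aligned}\]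 -/

import Mathlib

open MeasureTheory ProbabilityTheory
open scoped NNReal Matrix Polynomial

namespace HyperjerkId

noncomputable section

/-! ### The Moore–Penrose pseudoinverse of a real matrix -/

/-- The four Penrose equations: `B` is a Moore–Penrose pseudoinverse of `A`. -/
def IsMoorePenrose {ι κ : Type*} [Fintype ι] [Fintype κ]
    (A : Matrix ι κ ℝ) (B : Matrix κ ι ℝ) : Prop :=
  A * B * A = A ∧ B * A * B = B ∧ (A * B)ᵀ = A * B ∧ (B * A)ᵀ = B * A

theorem IsMoorePenrose.unique {ι κ : Type*} [Fintype ι] [Fintype κ]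
    {A : Matrix ι κ ℝ} {B C : Matrix κ ι ℝ}
    (hB : IsMoorePenrose A B) (hC : IsMoorePenrose A C) : B = C := by
  obtain ⟨b1, b2, b3, b4⟩ := hB
  obtain ⟨c1, c2, c3, c4⟩ := hC
  have h1 : A * B = A * C := by
    calc A * B = (A * B)ᵀ := b3.symm
      _ = ((A * C) * (A * B))ᵀ := by rw [← Matrix.mul_assoc, c1]
      _ = (A * B) * (A * C) := by rw [Matrix.transpose_mul, b3, c3]
      _ = A * C := by rw [← Matrix.mul_assoc, b1]
  have h2 : B * A = C * A := by
    calc B * A = (B * A)ᵀ := b4.symm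
      _ = ((B * A) * (C * A))ᵀ := by
          rw [Matrix.mul_assoc B A, ← Matrix.mul_assoc A C, c1]
      _ = (C * A) * (B * A) := by rw [Matrix.transpose_mul, b4, c4]
      _ = C * A := by rw [Matrix.mul_assoc C A, ← Matrix.mul_assoc A B, b1]
  calc B = B * A * B := b2.symm
    _ = C * A * C := by rw [Matrix.mul_assoc, h1, ← Matrix.mul_assoc, h2]
    _ = C := c2

theorem exists_isMoorePenrose {ι κ : Type*} [Fintype ι] [Fintype κ]
    (A : Matrix ι κ ℝ) : ∃ B : Matrix κ ι ℝ, IsMoorePenrose A B := by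
  classical
  have hG : (Aᵀ * A).IsHermitian := by
    simp [Matrix.IsHermitian, Matrix.conjTranspose_eq_transpose_of_trivial, Matrix.transpose_mul]
  obtain ⟨U, d, hU, hGd⟩ : ∃ (U : Matrix κ κ ℝ) (d : κ → ℝ), Uᵀ * U = 1 ∧
      Aᵀ * A = U * Matrix.diagonal d * Uᵀ := by
    refine ⟨hG.eigenvectorUnitary, hG.eigenvalues, ?_, ?_⟩
    · have := Unitary.coe_star_mul_self hG.eigenvectorUnitary
      simpa [Matrix.star_eq_conjTranspose, Matrix.conjTranspose_eq_transpose_of_trivial] using this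
    · have := hG.spectral_theorem
      rw [Unitary.conjStarAlgAut_apply] at this
      simpa [Matrix.star_eq_conjTranspose, Matrix.conjTranspose_eq_transpose_of_trivial,
        Function.comp_def] using this
  set G := Aᵀ * A with hGdef
  set K : Matrix κ κ ℝ := U * Matrix.diagonal (fun i => (d i)⁻¹) * Uᵀ with hK
  have key : ∀ a b : κ → ℝ, (U * Matrix.diagonal a * Uᵀ) * (U * Matrix.diagonal b * Uᵀ) =
      U * Matrix.diagonal (fun i => a i * b i) * Uᵀ := by
    intro a b
    calc (U * Matrix.diagonal a * Uᵀ) * (U * Matrix.diagonal b * Uᵀ)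
        = U * Matrix.diagonal a * (Uᵀ * U) * Matrix.diagonal b * Uᵀ := by
          simp only [Matrix.mul_assoc]
      _ = _ := by rw [hU, Matrix.mul_one, Matrix.mul_assoc U, Matrix.diagonal_mul_diagonal]
  have hKt : Kᵀ = K := by
    rw [hK]; simp [Matrix.transpose_mul, Matrix.mul_assoc]
  have hGt : Gᵀ = G := by simp [hGdef, Matrix.transpose_mul]
  have hGK : G * K = K * G := by
    rw [hGd, hK, key, key]; simp [mul_comm]
  have hKGK : K * G * K = K := by
    rw [hGd, hK, key, key]
    congr 3; funext i; by_cases h : d i = 0 <;> simp [h]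
  have hGKG : G * K * G = G := by
    rw [hGd, hK, key, key]
    congr 3; funext i; by_cases h : d i = 0 <;> simp [h]
  have hA : A * K * G = A := by
    have h0 : (A * K * G - A)ᵀ * (A * K * G - A) = 0 := by
      have e : (A * K * G - A)ᵀ * (A * K * G - A) =
          G * K * G * (K * G) - G * K * G - (G * (K * G) - G) := by
        simp only [Matrix.transpose_sub, Matrix.transpose_mul, hKt, Matrix.sub_mul,
          Matrix.mul_sub, Matrix.mul_assoc, hGdef, Matrix.transpose_transpose]
      rw [e, hGKG]; simp
    have h1 := Matrix.conjTranspose_mul_self_eq_zero (A := A * K * G - A)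
    rw [Matrix.conjTranspose_eq_transpose_of_trivial] at h1
    exact sub_eq_zero.mp (h1.mp h0)
  refine ⟨K * Aᵀ, ?_, ?_, ?_, ?_⟩
  · rw [← Matrix.mul_assoc, Matrix.mul_assoc (A * K), ← hGdef, hA]
  · rw [Matrix.mul_assoc K, ← hGdef, ← Matrix.mul_assoc, hKGK]
  · simp [Matrix.transpose_mul, hKt, Matrix.mul_assoc]
  · rw [Matrix.mul_assoc K, ← hGdef, Matrix.transpose_mul, hKt, hGt, hGK]

/-- The Moore–Penrose pseudoinverse `A†` (it exists and is unique). -/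
def pinv {ι κ : Type*} [Fintype ι] [Fintype κ] (A : Matrix ι κ ℝ) : Matrix κ ι ℝ :=
  Classical.choose (exists_isMoorePenrose A)

theorem isMoorePenrose_pinv {ι κ : Type*} [Fintype ι] [Fintype κ] (A : Matrix ι κ ℝ) :
    IsMoorePenrose A (pinv A) :=
  Classical.choose_spec (exists_isMoorePenrose A)

/-- Least singular value of a matrix with `p` columns: the last entry of its decreasing list of
`p` singular values (it is positive exactly when `p ≥ 1` and the matrix has rank `p`). -/
def sigmaMin {k p : ℕ} (A : Matrix (Fin k) (Fin p) ℝ) : ℝ :=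
  (Matrix.toEuclideanLin A).singularValues (p - 1)

/-! ### Trajectory and data -/

/-- The `j`-th sampling time `j T / n`. -/
def sampleTime (T : ℝ) (n j : ℕ) : ℝ := j * T / n

/-- The `d`-th time derivative of `y` on `[0, T]` (one-sided at the end points). -/
def timeDeriv (T : ℝ) (y : ℝ → ℝ) (d : ℕ) (t : ℝ) : ℝ :=
  iteratedDerivWithin d y (Set.Icc 0 T) t

/-- The vector `(y(t), y'(t), …, y^{(k-1)}(t))`. With `k = m` this is the state `ξ(t)`; with
`k = m + 1` and `t = t_i` it is the augmented state `x_i`. -/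
def jet (T : ℝ) (y : ℝ → ℝ) (k : ℕ) (t : ℝ) : EuclideanSpace ℝ (Fin k) :=
  WithLp.toLp 2 fun d => timeDeriv T y d t

/-- The data `z_j = y(jT/n) + w(jT/n)`; here for one outcome `ω`. -/
def observation {Ω : Type*} (T : ℝ) (n : ℕ) (y : ℝ → ℝ) (w : ℝ → Ω → ℝ) (ω : Ω) (j : ℕ) : ℝ :=
  y (sampleTime T n j) + w (sampleTime T n j) ω

/-! ### The differentiation filter -/

/-- `⟨f, g⟩_N = N⁻¹ ∑_{j=1}^N ρ(j/N) f(j/N) g(j/N)`. -/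
def discreteInner (ρ : ℝ → ℝ) (N : ℕ) (f g : ℝ[X]) : ℝ :=
  (1 / (N : ℝ)) * ∑ j ∈ Finset.Icc 1 N,
    ρ ((j : ℝ) / N) * f.eval ((j : ℝ) / N) * g.eval ((j : ℝ) / N)

/-- `P 0, …, P (N-1)` are polynomials with `deg P d = d` that are orthogonal for `⟨·,·⟩_N`. -/
structure IsOrthogonalFamily (ρ : ℝ → ℝ) (N : ℕ) (P : ℕ → ℝ[X]) : Prop where
  degree_eq : ∀ d < N, (P d).degree = (d : WithBot ℕ)
  orthogonal : ∀ d < N, ∀ d' < N, d ≠ d' → discreteInner ρ N (P d) (P d') = 0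

/-- `h_N^d`. -/
def filterH (ρ : ℝ → ℝ) (N : ℕ) (P : ℕ → ℝ[X]) (d : ℕ) : ℝ :=
  (1 / (N : ℝ)) * ∑ j ∈ Finset.Icc 1 N,
    ρ ((j : ℝ) / N) * (P d).eval ((j : ℝ) / N) * ((j : ℝ) / N) ^ d

/-- `g_N^d`. -/
def filterG (ρ : ℝ → ℝ) (N : ℕ) (P : ℕ → ℝ[X]) (d : ℕ) : ℝ :=
  (1 / (N : ℝ)) * ∑ j ∈ Finset.Icc 1 N, ρ ((j : ℝ) / N) * |(P d).eval ((j : ℝ) / N)|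

/-- The estimate of the `d`-th derivative at time `a T / n` from the data `z_{a+1}, …, z_{a+N}`. -/
def derivEstimate (T : ℝ) (n N : ℕ) (ρ : ℝ → ℝ) (P : ℕ → ℝ[X]) (z : ℕ → ℝ) (a d : ℕ) : ℝ :=
  ((d.factorial : ℝ) * (n : ℝ) ^ d / ((N : ℝ) ^ (d + 1) * T ^ d * filterH ρ N P d)) *
    ∑ j ∈ Finset.Icc 1 N, ρ ((j : ℝ) / N) * (P d).eval ((j : ℝ) / N) * z (a + j)

/-- The estimate `x̂_i ∈ ℝ^{m+1}` of the augmented state, for the window starting after sample `a`. -/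
def jetEstimate (T : ℝ) (n N m : ℕ) (ρ : ℝ → ℝ) (P : ℕ → ℝ[X]) (z : ℕ → ℝ) (a : ℕ) :
    EuclideanSpace ℝ (Fin (m + 1)) :=
  WithLp.toLp 2 fun d => derivEstimate T n N ρ P z a d

/-- `M_i^d`: the supremum of `|y^{(d+1)}|` over the window `[aT/n, (a+N)T/n]`. -/
def windowSup (T : ℝ) (n N : ℕ) (y : ℝ → ℝ) (a d : ℕ) : ℝ :=
  sSup ((fun t => |timeDeriv T y (d + 1) t|) ''
    Set.Icc (sampleTime T n a) (sampleTime T n a + N * T / n))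

/-- `A_{i,N}^d = (M_i^d T / (d+1))² (g_N^d / h_N^d)²`. -/
def biasConst (T : ℝ) (n N : ℕ) (ρ : ℝ → ℝ) (P : ℕ → ℝ[X]) (y : ℝ → ℝ) (a d : ℕ) : ℝ :=
  (windowSup T n N y a d * T / (d + 1)) ^ 2 * (filterG ρ N P d / filterH ρ N P d) ^ 2

/-- `(s_{i,N}^d)²`. -/
def noiseConst {Ω : Type*} [MeasurableSpace Ω] (μ : Measure Ω) (T : ℝ) (n N : ℕ) (ρ : ℝ → ℝ)
    (P : ℕ → ℝ[X]) (w : ℝ → Ω → ℝ) (a d : ℕ) : ℝ :=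
  (1 / (N : ℝ)) * ∑ j ∈ Finset.Icc 1 N, ρ ((j : ℝ) / N) ^ 2 * (P d).eval ((j : ℝ) / N) ^ 2 *
    Var[w (sampleTime T n (a + j)); μ]

/-- `B_{i,N}^d = (d! s_{i,N}^d / (T^d h_N^d))²`. -/
def varConst {Ω : Type*} [MeasurableSpace Ω] (μ : Measure Ω) (T : ℝ) (n N : ℕ) (ρ : ℝ → ℝ)
    (P : ℕ → ℝ[X]) (w : ℝ → Ω → ℝ) (a d : ℕ) : ℝ :=
  ((d.factorial : ℝ) / (T ^ d * filterH ρ N P d)) ^ 2 * noiseConst μ T n N ρ P w a d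

/-- `Ã_N = ∑_i ∑_{d ≤ m} A_{i,N}^d`. -/
def totalBiasConst {n' : ℕ} (T : ℝ) (n N m : ℕ) (ρ : ℝ → ℝ) (P : ℕ → ℝ[X]) (y : ℝ → ℝ)
    (s : Fin n' → ℕ) : ℝ :=
  ∑ i, ∑ d ∈ Finset.range (m + 1), biasConst T n N ρ P y (s i) d

/-- `B̃_N = ∑_i ∑_{d ≤ m} B_{i,N}^d`. -/
def totalVarConst {Ω : Type*} [MeasurableSpace Ω] (μ : Measure Ω) {n' : ℕ} (T : ℝ) (n N m : ℕ)
    (ρ : ℝ → ℝ) (P : ℕ → ℝ[X]) (w : ℝ → Ω → ℝ) (s : Fin n' → ℕ) : ℝ :=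
  ∑ i, ∑ d ∈ Finset.range (m + 1), varConst μ T n N ρ P w (s i) d

/-- The optimised window length `((2m+1) B / (2A))^{1/(2m+3)} n^{(2m+2)/(2m+3)}`. -/
def optimalWindow (m n : ℕ) (A B : ℝ) : ℝ :=
  ((2 * m + 1) * B / (2 * A)) ^ (1 / (2 * m + 3) : ℝ) *
    (n : ℝ) ^ ((2 * m + 2) / (2 * m + 3) : ℝ)

/-- `ε_N = 2 (2m+1)^{1/(2m+3)} A^{(2m+1)/(2m+3)} B^{2/(2m+3)} (n')⁻¹`. -/
def epsilonN (m n' : ℕ) (A B : ℝ) : ℝ :=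
  2 * (2 * m + 1 : ℝ) ^ (1 / (2 * m + 3) : ℝ) * A ^ ((2 * m + 1) / (2 * m + 3) : ℝ) *
    B ^ (2 / (2 * m + 3) : ℝ) / n'

/-! ### The regularised least squares estimator -/

/-- The projection `P` of the augmented state onto its first `m` entries. -/
def firstEntries {m : ℕ} (x : EuclideanSpace ℝ (Fin (m + 1))) : EuclideanSpace ℝ (Fin m) :=
  WithLp.toLp 2 fun k => x k.castSucc

/-- The `n' × p` matrix with rows `φ(P x_i)ᵀ`. -/
def featureMatrix {m p n' : ℕ} (φ : EuclideanSpace ℝ (Fin m) → EuclideanSpace ℝ (Fin p))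
    (x : Fin n' → EuclideanSpace ℝ (Fin (m + 1))) : Matrix (Fin n') (Fin p) ℝ :=
  Matrix.of fun i k => φ (firstEntries (x i)) k

/-- The vector `(0_p, x_1^m, …, x_{n'}^m)`. -/
def target {m n' : ℕ} (p : ℕ) (x : Fin n' → EuclideanSpace ℝ (Fin (m + 1))) :
    EuclideanSpace ℝ (Fin p ⊕ Fin n') :=
  WithLp.toLp 2 (Sum.elim (fun _ => 0) fun i => x i (Fin.last m))

/-- The estimator `θ̂ = R̂† û`, where `R̂` is `l I_p` stacked on the feature matrix. It is a function
of the regularisation parameter `l` and of the (estimated) augmented states only. -/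
def ridgeEstimate {m p n' : ℕ} (l : ℝ)
    (φ : EuclideanSpace ℝ (Fin m) → EuclideanSpace ℝ (Fin p))
    (x : Fin n' → EuclideanSpace ℝ (Fin (m + 1))) : EuclideanSpace ℝ (Fin p) :=
  WithLp.toLp 2
    (pinv (Matrix.fromRows (l • (1 : Matrix (Fin p) (Fin p) ℝ)) (featureMatrix φ x)) *ᵥ
      (target p x).ofLp)

/-- The right-hand side of the moment bound, with `σ` for the normalised least singular value
`σ̄` and `U` for `Ū`. -/
def firstMomentBound (m n n' : ℕ) (α C ε εm σ U l : ℝ) : ℝ :=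
  εm ^ (1 / 2 : ℝ) / (σ * (n : ℝ) ^ (1 / (2 * m + 3) : ℝ))
  + 4 * U * l / (σ ^ 2 * √n')
  + 6 * C ^ 2 * U * ε ^ α / (n : ℝ) ^ (2 * α / (2 * m + 3) : ℝ) *
      (2 * Real.log (σ * √n' / l) / σ ^ 3 + √n' / (l * σ ^ 2))
  + 4 * C ^ (2 / α) * U * ε * √n' / (l * σ ^ (2 / α) * (n : ℝ) ^ (2 / (2 * m + 3) : ℝ))
  + (2 : ℝ) ^ (2 - α / 2) * εm ^ (1 / 2 : ℝ) / (n : ℝ) ^ (1 / (2 * m + 3) : ℝ) *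
      (C ^ (2 / α) * ε * (n' : ℝ) ^ (1 / α) /
          (l ^ (2 / α) * σ ^ (2 / α) * (n : ℝ) ^ (2 / (2 * m + 3) : ℝ))
        + 1 / σ ^ (2 / α)) ^ (α / 2)

end

end HyperjerkId

open HyperjerkId

/-!
Fix an outcome and write `v = Φ θ` and `v'` for the exact and the estimated top derivatives, `f` for
`‖v' - v‖`, `δ` for the Frobenius norm of the perturbation of the feature matrix, `S` for the least
singular value of `Φ` and `l` for the regularisation parameter. The estimate solves the normal
equation of ridge regression, and testing this equation against the error, respectively against the
estimate itself, gives
`‖Δθ‖ ≤ (f / S) (2 + δ / l) + ‖v‖ (2 l / S² + 6 δ² / (l S²))`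
(`norm_sub_le_of_normal_eq`). If `δ ≤ S / 2`, the perturbed matrix is still bounded below by
`S / 2`; otherwise the bound `‖v'‖ / (2 l)` on the estimate suffices, since `1 ≤ 4 δ² / S²`. The
term of first order in `δ` is absorbed by `2 δ ≤ l + δ² / l`.

Taking expectations, only `E f²` and `E δ²` are needed, the product `f δ` being handled by the
Cauchy–Schwarz inequality. Hölder continuity of `φ` and Jensen's inequality for the concave function
`z ↦ z ^ α` (`integral_sum_rpow_le`) give `E δ² ≤ C² n' ε ^ α n ^ (-2α/(2m+3))`. The resulting
bound is smaller than the stated one (`le_firstMomentBound`), in which the logarithmic term and the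
term `4 C ^ (2/α) U ε …` are only used through their nonnegativity.

The admissible value of `ε` comes from a bias-variance decomposition. Orthogonality makes the filter
exact on polynomials of degree at most `d`, so its bias is the Taylor remainder
(`abs_derivEstimate_sub_le`), and for uncorrelated noise the variance is a weighted sum of
variances (`integral_derivEstimate_noise_sq`). The optimised window length balances the two
(`bias_add_variance_le_of_optimalWindow`).
-/

namespace HyperjerkId

/-! ### Ridge regression with perturbed data -/

/-- The singular value with index `dim E - 1`, the least of the decreasing list, bounds `L` from
below: expand `‖L a‖²` in an orthonormal eigenbasis of `L* L`. -/
theorem singularValues_mul_norm_le {E F : Type*} [NormedAddCommGroup E] [InnerProductSpace ℝ E]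
    [FiniteDimensional ℝ E] [NormedAddCommGroup F] [InnerProductSpace ℝ F]
    [FiniteDimensional ℝ F] (L : E →ₗ[ℝ] F) {k : ℕ} (hk : Module.finrank ℝ E = k) (a : E) :
    L.singularValues (k - 1) * ‖a‖ ≤ ‖L a‖ := by
  have hT := L.isSymmetric_adjoint_comp_self
  set b := hT.eigenvectorBasis hk with hb
  have e1 : ‖L a‖ ^ 2 = inner ℝ (L.adjoint (L a)) a := by
    rw [LinearMap.adjoint_inner_left, real_inner_self_eq_norm_sq]
  have e2 : inner ℝ (L.adjoint (L a)) a = ∑ i, hT.eigenvalues hk i * (inner ℝ (b i) a) ^ 2 := by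
    rw [← b.sum_inner_mul_inner]
    refine Finset.sum_congr rfl fun i _ => ?_
    have h : inner ℝ ((L.adjoint ∘ₗ L) a) (b i) = inner ℝ a ((L.adjoint ∘ₗ L) (b i)) := hT a (b i)
    rw [hb, hT.apply_eigenvectorBasis hk i, ← hb, inner_smul_right] at h
    rw [LinearMap.comp_apply] at h
    rw [h, real_inner_comm a (b i)]
    simp [sq, mul_assoc]
  have h3 : (L.singularValues (k - 1) * ‖a‖) ^ 2 ≤ ‖L a‖ ^ 2 := by
    rw [e1, e2, mul_pow, ← b.sum_sq_inner_right a, Finset.mul_sum]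
    refine Finset.sum_le_sum fun i _ => mul_le_mul_of_nonneg_right ?_ (sq_nonneg _)
    rw [← L.sq_singularValues_fin hk i]
    have := L.singularValues_nonneg (k - 1)
    have h4 : L.singularValues (k - 1) ≤ L.singularValues i :=
      L.singularValues_antitone (by have := i.2; omega)
    gcongr
  exact le_of_sq_le_sq h3 (norm_nonneg _)

theorem sigmaMin_mul_norm_le {k p : ℕ} (A : Matrix (Fin k) (Fin p) ℝ)
    (a : EuclideanSpace ℝ (Fin p)) : sigmaMin A * ‖a‖ ≤ ‖Matrix.toEuclideanLin A a‖ :=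
  singularValues_mul_norm_le _ (by simp) a

theorem IsMoorePenrose.transpose_mul_mul {ι κ : Type*} [Fintype ι] [Fintype κ]
    {A : Matrix ι κ ℝ} {B : Matrix κ ι ℝ} (h : IsMoorePenrose A B) : Aᵀ * A * B = Aᵀ := by
  obtain ⟨h1, -, h3, -⟩ := h
  rw [Matrix.mul_assoc, ← h3, ← Matrix.transpose_mul, h1]

/-- The normal equation of ridge regression. -/
theorem ridgeEstimate_normal_eq {m p n' : ℕ} (l : ℝ)
    (φ : EuclideanSpace ℝ (Fin m) → EuclideanSpace ℝ (Fin p))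
    (x : Fin n' → EuclideanSpace ℝ (Fin (m + 1))) :
    (l ^ 2) • (ridgeEstimate l φ x).ofLp +
      (featureMatrix φ x)ᵀ *ᵥ (featureMatrix φ x *ᵥ (ridgeEstimate l φ x).ofLp) =
      (featureMatrix φ x)ᵀ *ᵥ fun i => x i (Fin.last m) := by
  set Φ := featureMatrix φ x
  set R := Matrix.fromRows (l • (1 : Matrix (Fin p) (Fin p) ℝ)) Φ with hR
  have h := congrArg (fun M => M *ᵥ (target p x).ofLp) (isMoorePenrose_pinv R).transpose_mul_mul
  have h2 : Rᵀ * R = l ^ 2 • (1 : Matrix (Fin p) (Fin p) ℝ) + Φᵀ * Φ := by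
    rw [hR, Matrix.transpose_fromRows, Matrix.fromCols_mul_fromRows]
    simp [smul_smul, sq]
  have h3 : Rᵀ *ᵥ (target p x).ofLp = Φᵀ *ᵥ fun i => x i (Fin.last m) := by
    have h0 : (fun _ => 0 : Fin p → ℝ) = 0 := rfl
    rw [hR, Matrix.transpose_fromRows]
    simp only [target, Matrix.fromCols_mulVec_sumElim]
    rw [h0]; simp
  simp only [← Matrix.mulVec_mulVec] at h
  rw [h3, Matrix.mulVec_mulVec, Matrix.mulVec_mulVec, h2, ← Matrix.mulVec_mulVec] at h
  rw [← h, Matrix.add_mulVec, Matrix.smul_mulVec, Matrix.one_mulVec, ← Matrix.mulVec_mulVec]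
  rfl

/-- Weak form of the normal equation: testing it against an arbitrary vector `a`. -/
theorem ridgeEstimate_inner_eq {m p n' : ℕ} (l : ℝ)
    (φ : EuclideanSpace ℝ (Fin m) → EuclideanSpace ℝ (Fin p))
    (x : Fin n' → EuclideanSpace ℝ (Fin (m + 1))) (a : EuclideanSpace ℝ (Fin p)) :
    l ^ 2 * inner ℝ a (ridgeEstimate l φ x) +
      inner ℝ (Matrix.toEuclideanLin (featureMatrix φ x) a)
        (Matrix.toEuclideanLin (featureMatrix φ x) (ridgeEstimate l φ x) -
          WithLp.toLp 2 fun i => x i (Fin.last m)) = 0 := by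
  have h := congrArg (fun v => v ⬝ᵥ a.ofLp) (ridgeEstimate_normal_eq l φ x)
  simp only [add_dotProduct, smul_dotProduct, Matrix.mulVec_transpose,
    ← Matrix.dotProduct_mulVec] at h
  rw [inner_sub_right]
  simp only [EuclideanSpace.inner_eq_star_dotProduct, Matrix.ofLp_toLpLin,
    Matrix.toLin'_apply, star_trivial]
  rw [smul_eq_mul] at h
  linarith

theorem continuous_featureMatrix {m p n' : ℕ}
    {φ : EuclideanSpace ℝ (Fin m) → EuclideanSpace ℝ (Fin p)} (hφ : Continuous φ) :
    Continuous (featureMatrix φ : (Fin n' → EuclideanSpace ℝ (Fin (m + 1))) → _) := by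
  unfold featureMatrix firstEntries
  refine continuous_matrix fun i k => ?_
  simp only [Matrix.of_apply]
  fun_prop

/-- The Gram matrix `l² I + Φᵀ Φ` is positive definite, so its inverse is the adjugate divided by a
nonvanishing determinant. This continuity gives the measurability of the estimation error. -/
theorem continuous_ridgeEstimate {m p n' : ℕ} {l : ℝ} (hl : l ≠ 0)
    {φ : EuclideanSpace ℝ (Fin m) → EuclideanSpace ℝ (Fin p)} (hφ : Continuous φ) :
    Continuous (ridgeEstimate l φ : (Fin n' → EuclideanSpace ℝ (Fin (m + 1))) → _) := by
  set G : (Fin n' → EuclideanSpace ℝ (Fin (m + 1))) → Matrix (Fin p) (Fin p) ℝ :=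
    fun x => l ^ 2 • (1 : Matrix (Fin p) (Fin p) ℝ) + (featureMatrix φ x)ᵀ * featureMatrix φ x
    with hG
  have hGc : Continuous G := by
    have := continuous_featureMatrix (n' := n') hφ
    exact continuous_const.add (this.matrix_transpose.matrix_mul this)
  have hdet : ∀ x, IsUnit (G x).det := by
    intro x
    have hp : (G x).PosDef := by
      refine Matrix.PosDef.add_posSemidef (Matrix.PosDef.one.smul (by positivity)) ?_
      simpa [Matrix.conjTranspose_eq_transpose_of_trivial] using
        Matrix.posSemidef_conjTranspose_mul_self (featureMatrix φ x)
    exact hp.det_pos.ne'.isUnit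
  have key : ∀ x : Fin n' → EuclideanSpace ℝ (Fin (m + 1)), ridgeEstimate l φ x =
      WithLp.toLp 2 (((G x).det⁻¹ • (G x).adjugate) *ᵥ
        ((featureMatrix φ x)ᵀ *ᵥ fun i => x i (Fin.last m))) := by
    intro x
    have h1 : (G x)⁻¹ = (G x).det⁻¹ • (G x).adjugate := by
      rw [Matrix.inv_def, Ring.inverse_eq_inv']
    have h2 : G x *ᵥ (ridgeEstimate l φ x).ofLp =
        (featureMatrix φ x)ᵀ *ᵥ fun i => x i (Fin.last m) := by
      rw [← ridgeEstimate_normal_eq l φ x, hG]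
      simp only [Matrix.add_mulVec, Matrix.smul_mulVec, Matrix.one_mulVec, ← Matrix.mulVec_mulVec]
    rw [← h1, ← h2, Matrix.mulVec_mulVec, Matrix.nonsing_inv_mul _ (hdet x), Matrix.one_mulVec]
  have : (ridgeEstimate l φ : (Fin n' → EuclideanSpace ℝ (Fin (m + 1))) → _) = _ := funext key
  rw [this]
  refine (PiLp.continuous_toLp 2 _).comp ?_
  refine Continuous.matrix_mulVec ?_
    ((continuous_featureMatrix hφ).matrix_transpose.matrix_mulVec ?_)
  · exact (hGc.matrix_det.inv₀ fun x => (hdet x).ne_zero).smul hGc.matrix_adjugate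
  · fun_prop

/-- Deterministic error bound for ridge regression. Let `L θ = v` with `L` bounded below by `S`, and
let `g` solve the normal equation for perturbed data `L'`, `v'`. The first summand is the effect of
`v' - v`. The second one is the effect of the regularisation and of the perturbation of `L`; it has
no term of first order in `δ`, because `2 δ ≤ l + δ² / l`. -/
theorem norm_sub_le_of_normal_eq {E F : Type*} [NormedAddCommGroup E] [InnerProductSpace ℝ E]
    [NormedAddCommGroup F] [InnerProductSpace ℝ F] {L L' : E →ₗ[ℝ] F} {θ g : E} {v' : F}
    {S l δ : ℝ} (hl : 0 < l) (hlS : l < S) (hδ0 : 0 ≤ δ) (hS : ∀ a, S * ‖a‖ ≤ ‖L a‖)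
    (hδ : ∀ a, ‖L' a - L a‖ ≤ δ * ‖a‖)
    (hg : ∀ a, l ^ 2 * inner ℝ a g + inner ℝ (L' a) (L' g - v') = 0) :
    ‖g - θ‖ ≤ ‖v' - L θ‖ / S * (2 + δ / l) +
      ‖L θ‖ * (2 * l / S ^ 2 + 6 * δ ^ 2 / (l * S ^ 2)) := by
  have hS0 : 0 < S := hl.trans hlS
  set f := ‖v' - L θ‖ with hf
  have hf0 : 0 ≤ f := norm_nonneg _
  have hτ : ‖θ‖ ≤ ‖L θ‖ / S := by rw [le_div_iff₀ hS0, mul_comm]; exact hS θ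
  set V := ‖L θ‖ with hV
  have hV0 : 0 ≤ V := norm_nonneg _
  rcases le_or_gt δ (S / 2) with hc | hc
  · -- the perturbed operator is still bounded below by `S / 2`
    have hb : ‖v' - L' θ‖ ≤ f + δ * ‖θ‖ := by
      have : v' - L' θ = (v' - L θ) - (L' θ - L θ) := by abel
      rw [this]
      exact (norm_sub_le _ _).trans (add_le_add le_rfl (hδ θ))
    have hs : S / 2 * ‖g - θ‖ ≤ ‖L' (g - θ)‖ := by
      have h1 := hS (g - θ)
      have h2 := hδ (g - θ)
      have h3 := norm_sub_norm_le (L (g - θ)) (L' (g - θ))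
      rw [norm_sub_rev] at h3
      nlinarith [norm_nonneg (g - θ)]
    have hen : l ^ 2 * ‖g - θ‖ ^ 2 + ‖L' (g - θ)‖ ^ 2 ≤
        ‖L' (g - θ)‖ * ‖v' - L' θ‖ + l ^ 2 * (‖g - θ‖ * ‖θ‖) := by
      have h1 := hg (g - θ)
      have h2 : L' g - v' = L' (g - θ) - (v' - L' θ) := by rw [map_sub]; abel
      have h3 : inner ℝ (g - θ) g = ‖g - θ‖ ^ 2 + inner ℝ (g - θ) θ := by
        rw [← real_inner_self_eq_norm_sq, ← inner_add_right, sub_add_cancel]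
      rw [h2, inner_sub_right, real_inner_self_eq_norm_sq, h3] at h1
      have h4 := real_inner_le_norm (L' (g - θ)) (v' - L' θ)
      have h5 := neg_le_of_abs_le (abs_real_inner_le_norm (g - θ) θ)
      nlinarith [sq_nonneg l]
    have hγ : ‖g - θ‖ ≤ 2 * ‖v' - L' θ‖ / S + l * ‖θ‖ / S := by
      set γ := ‖g - θ‖
      set s := ‖L' (g - θ)‖
      set b := ‖v' - L' θ‖
      set τ := ‖θ‖
      have hγ0 : 0 ≤ γ := norm_nonneg _
      have hb0 : 0 ≤ b := norm_nonneg _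
      have hτ0 : 0 ≤ τ := norm_nonneg _
      by_contra! hcon
      rw [← add_div, div_lt_iff₀ hS0] at hcon
      have hγp : 0 < γ := by
        by_contra! h
        have : γ = 0 := le_antisymm h hγ0
        rw [this] at hcon
        have : 0 ≤ l * τ := by positivity
        linarith
      -- `s (s - b)` increases in `s`, so `s` may be replaced by its lower bound
      have h1 : S / 2 * γ * (S / 2 * γ - b) ≤ s * (s - b) := by
        have : 0 ≤ l * τ := by positivity
        nlinarith
      have h2 : S / 2 * γ * (l * τ / 2) < S / 2 * γ * (S / 2 * γ - b) := by
        apply mul_lt_mul_of_pos_left _ (by positivity); linarith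
      have h3 : l ^ 2 * (γ * (l * τ)) ≤ l ^ 2 * (γ * (γ * S)) := by
        have : l * τ ≤ γ * S := by linarith
        exact mul_le_mul_of_nonneg_left (mul_le_mul_of_nonneg_left this hγ0) (sq_nonneg l)
      have h4 : γ * (l ^ 2 * (γ * S) + S * (S / 2 * (l * τ / 2))) <
          γ * (S * (l ^ 2 * τ)) := by nlinarith
      have h5 := lt_of_mul_lt_mul_left h4 hγ0
      have h6 : l * (l * τ) ≤ l * (γ * S) := mul_le_mul_of_nonneg_left (by linarith) hl.le
      nlinarith [mul_nonneg (mul_nonneg hl.le hτ0) (sq_nonneg (l - S / 2)),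
        mul_le_mul_of_nonneg_left h6 hl.le]
    have e1 : 2 * ‖v' - L' θ‖ / S + l * ‖θ‖ / S ≤
        2 * f / S + (2 * δ + l) * (V / S) / S := by
      rw [← add_div, ← add_div]
      refine div_le_div_of_nonneg_right ?_ hS0.le
      have := mul_le_mul_of_nonneg_left hτ (by positivity : 0 ≤ 2 * δ + l)
      linarith
    have e2 : 2 * δ ≤ l + δ ^ 2 / l := by
      have : 0 ≤ (l - δ) ^ 2 / l := by positivity
      have h : (l - δ) ^ 2 / l = l + δ ^ 2 / l - 2 * δ := by field_simp; ring
      linarith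
    have e3 : (2 * δ + l) * (V / S) / S ≤ (2 * l + δ ^ 2 / l) * (V / S) / S := by
      exact div_le_div_of_nonneg_right
        (mul_le_mul_of_nonneg_right (by linarith) (by positivity)) hS0.le
    have e4 : (2 * l + δ ^ 2 / l) * (V / S) / S =
      V * (2 * l / S ^ 2 + 1 * δ ^ 2 / (l * S ^ 2)) := by field_simp
    have e5 : V * (2 * l / S ^ 2 + 1 * δ ^ 2 / (l * S ^ 2)) ≤
      V * (2 * l / S ^ 2 + 6 * δ ^ 2 / (l * S ^ 2)) := by gcongr; norm_num
    have e6 : 2 * f / S ≤ f / S * (2 + δ / l) := by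
      have : 0 ≤ f / S * (δ / l) := by positivity
      have h : 2 * f / S = f / S * 2 := by ring
      rw [h, mul_add]; linarith
    linarith
  · -- only the lower bound `l` of the regularised operator is left
    have hgn : ‖g‖ ≤ ‖v'‖ / (2 * l) := by
      have h1 := hg g
      rw [inner_sub_right, real_inner_self_eq_norm_sq, real_inner_self_eq_norm_sq] at h1
      have h2 := real_inner_le_norm (L' g) v'
      rw [le_div_iff₀ (by positivity)]
      refine le_of_sq_le_sq ?_ (norm_nonneg _)
      nlinarith [sq_nonneg (2 * ‖L' g‖ - ‖v'‖)]
    have hv' : ‖v'‖ ≤ f + V := by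
      have := norm_add_le (v' - L θ) (L θ)
      rwa [sub_add_cancel] at this
    have e1 : ‖g - θ‖ ≤ (f + V) / (2 * l) + V / S := by
      refine (norm_sub_le _ _).trans (add_le_add (hgn.trans ?_) hτ)
      gcongr
    have e2 : V / S ≤ V / l := by gcongr
    have h1 : S ^ 2 ≤ 4 * δ ^ 2 := by nlinarith
    have e3 : f / (2 * l) ≤ f / S * (δ / l) := by
      rw [div_mul_div_comm, div_le_div_iff₀ (by positivity) (by positivity)]
      have : f * l * S ≤ f * l * (2 * δ) := by gcongr; linarith
      linarith
    have e4 : V / (2 * l) + V / l ≤ V * (6 * δ ^ 2 / (l * S ^ 2)) := by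
      have : V / (2 * l) + V / l = V * ((3 / 2 * S ^ 2) / (l * S ^ 2)) := by field_simp; ring
      rw [this]
      exact mul_le_mul_of_nonneg_left
        (div_le_div_of_nonneg_right (by linarith) (by positivity)) hV0
    have e5 : 0 ≤ V * (2 * l / S ^ 2) := by positivity
    have e6 : 0 ≤ f / S * 2 := by positivity
    rw [mul_add, mul_add]
    rw [add_div] at e1
    linarith

/-! ### Moments of the perturbations -/

/-- The graph of the concave function `z ↦ z ^ α` lies below its tangent line at `Y`. -/
theorem rpow_le_tangent {α Y z : ℝ} (hα₀ : 0 ≤ α) (hα₁ : α ≤ 1) (hY : 0 < Y) (hz : 0 ≤ z) :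
    z ^ α ≤ Y ^ α * (1 - α + α * (z / Y)) := by
  have h := rpow_one_add_le_one_add_mul_self (s := z / Y - 1)
    (by have : 0 ≤ z / Y := by positivity
        linarith) hα₀ hα₁
  have e : z ^ α = Y ^ α * (1 + (z / Y - 1)) ^ α := by
    rw [add_sub_cancel, Real.div_rpow hz hY.le]
    have := (Real.rpow_pos_of_pos hY α).ne'
    field_simp
  rw [e]
  exact mul_le_mul_of_nonneg_left (h.trans (by linarith)) (by positivity)

theorem integrable_rpow_of_le_one {Ω : Type*} [MeasurableSpace Ω] {μ : Measure Ω}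
    [IsFiniteMeasure μ] {α : ℝ} (hα₀ : 0 ≤ α) (hα₁ : α ≤ 1) {z : Ω → ℝ} (hz₀ : ∀ ω, 0 ≤ z ω)
    (hz : Integrable z μ) : Integrable (fun ω => z ω ^ α) μ := by
  refine ((integrable_const (1 : ℝ)).add hz).mono'
    (hz.aestronglyMeasurable.aemeasurable.pow_const α).aestronglyMeasurable (.of_forall fun ω => ?_)
  rw [Real.norm_of_nonneg (Real.rpow_nonneg (hz₀ ω) α)]
  have := rpow_le_tangent hα₀ hα₁ one_pos (hz₀ ω)
  simp only [Real.one_rpow, div_one, one_mul] at this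
  simp only [Pi.add_apply]
  nlinarith [hz₀ ω]

/-- Jensen's inequality for `z ↦ z ^ α`, jointly over the probability space and over the index. -/
theorem integral_sum_rpow_le {Ω : Type*} [MeasurableSpace Ω] {μ : Measure Ω}
    [IsProbabilityMeasure μ] {ι : Type*} [Fintype ι] {α Y : ℝ} (hα₀ : 0 < α) (hα₁ : α ≤ 1)
    (hY : 0 ≤ Y) {z : ι → Ω → ℝ} (hz₀ : ∀ i ω, 0 ≤ z i ω) (hz : ∀ i, Integrable (z i) μ)
    (h : ∫ ω, ∑ i, z i ω ∂μ ≤ Fintype.card ι * Y) :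
    ∫ ω, ∑ i, z i ω ^ α ∂μ ≤ Fintype.card ι * Y ^ α := by
  have hpos : ∀ Y' : ℝ, Y < Y' → ∫ ω, ∑ i, z i ω ^ α ∂μ ≤ Fintype.card ι * Y' ^ α := by
    intro Y' hYY'
    have hY' : 0 < Y' := hY.trans_lt hYY'
    have hint : Integrable (fun ω => ∑ i, z i ω) μ := integrable_finsetSum _ fun i _ => hz i
    calc ∫ ω, ∑ i, z i ω ^ α ∂μ
        ≤ ∫ ω, Y' ^ α * (Fintype.card ι * (1 - α) + α / Y' * ∑ i, z i ω) ∂μ := by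
          refine integral_mono (integrable_finsetSum _ fun i _ =>
            integrable_rpow_of_le_one hα₀.le hα₁ (hz₀ i) (hz i))
            (((integrable_const _).add (hint.const_mul _)).const_mul _) fun ω => ?_
          refine (Finset.sum_le_sum fun i _ => rpow_le_tangent hα₀.le hα₁ hY' (hz₀ i ω)).trans_eq ?_
          rw [← Finset.mul_sum, Finset.sum_add_distrib, Finset.sum_const, Finset.card_univ,
            nsmul_eq_mul, Finset.mul_sum]
          congr 2
          exact Finset.sum_congr rfl fun i _ => by ring
      _ = Y' ^ α * (Fintype.card ι * (1 - α) + α / Y' * ∫ ω, ∑ i, z i ω ∂μ) := by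
          rw [integral_const_mul, integral_add (integrable_const _) (hint.const_mul _),
            integral_const_mul (α / Y')]
          simp
      _ ≤ Y' ^ α * (Fintype.card ι * (1 - α) + α / Y' * (Fintype.card ι * Y')) := by
          have : (Fintype.card ι : ℝ) * Y ≤ Fintype.card ι * Y' := by gcongr
          have := h.trans this
          gcongr
      _ = Fintype.card ι * Y' ^ α := by field_simp; ring
  -- the tangent line exists only at positive points, so the case `Y = 0` is reached as a limit
  have hlim : Filter.Tendsto (fun Y' : ℝ => (Fintype.card ι : ℝ) * Y' ^ α)
      (nhdsWithin Y (Set.Ioi Y)) (nhds (Fintype.card ι * Y ^ α)) :=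
    (((Real.continuousAt_rpow_const Y α (Or.inr hα₀.le)).const_mul _).tendsto).mono_left
      nhdsWithin_le_nhds
  exact ge_of_tendsto hlim (Filter.eventually_of_mem self_mem_nhdsWithin hpos)

theorem integral_mul_le_of_integral_sq_le {Ω : Type*} [MeasurableSpace Ω] {μ : Measure Ω}
    {f g : Ω → ℝ} {a b : ℝ} (hf₀ : ∀ ω, 0 ≤ f ω) (hg₀ : ∀ ω, 0 ≤ g ω)
    (hf : MemLp f 2 μ) (hg : MemLp g 2 μ) (ha : 0 ≤ a) (hb : 0 ≤ b)
    (hfa : ∫ ω, f ω ^ 2 ∂μ ≤ a ^ 2) (hgb : ∫ ω, g ω ^ 2 ∂μ ≤ b ^ 2) :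
    ∫ ω, f ω * g ω ∂μ ≤ a * b := by
  have h := integral_mul_le_Lp_mul_Lq_of_nonneg Real.HolderConjugate.two_two
    (.of_forall hf₀) (.of_forall hg₀) (by simpa using hf) (by simpa using hg)
  simp only [Real.rpow_two, ← Real.sqrt_eq_rpow] at h
  exact h.trans (mul_le_mul (Real.sqrt_le_iff.2 ⟨ha, hfa⟩) (Real.sqrt_le_iff.2 ⟨hb, hgb⟩)
    (Real.sqrt_nonneg _) ha)

theorem norm_firstEntries_le {m : ℕ} (x : EuclideanSpace ℝ (Fin (m + 1))) :
    ‖firstEntries x‖ ≤ ‖x‖ := by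
  refine le_of_sq_le_sq ?_ (norm_nonneg _)
  rw [EuclideanSpace.norm_sq_eq, EuclideanSpace.norm_sq_eq, Fin.sum_univ_castSucc]
  exact le_add_of_nonneg_right (sq_nonneg _)

theorem firstEntries_sub {m : ℕ} (x y : EuclideanSpace ℝ (Fin (m + 1))) :
    firstEntries (x - y) = firstEntries x - firstEntries y := rfl

theorem continuous_firstEntries {m : ℕ} :
    Continuous (firstEntries : EuclideanSpace ℝ (Fin (m + 1)) → _) := by
  unfold firstEntries
  fun_prop

/-- Hölder continuity of the feature map, in terms of squared norms of the full augmented states. -/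
theorem sq_norm_feature_sub_le {m p : ℕ}
    {φ : EuclideanSpace ℝ (Fin m) → EuclideanSpace ℝ (Fin p)} {α C : ℝ≥0} (hφ : HolderWith C α φ)
    (x y : EuclideanSpace ℝ (Fin (m + 1))) :
    ‖φ (firstEntries x) - φ (firstEntries y)‖ ^ 2 ≤ C ^ 2 * (‖x - y‖ ^ 2) ^ (α : ℝ) := by
  have h := hφ.dist_le (firstEntries x) (firstEntries y)
  rw [dist_eq_norm, dist_eq_norm, ← firstEntries_sub] at h
  have h2 : ‖firstEntries (x - y)‖ ^ (α : ℝ) ≤ ‖x - y‖ ^ (α : ℝ) :=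
    Real.rpow_le_rpow (norm_nonneg _) (norm_firstEntries_le _) α.2
  have h3 : (‖x - y‖ ^ 2) ^ (α : ℝ) = (‖x - y‖ ^ (α : ℝ)) ^ 2 := by
    rw [← Real.rpow_natCast, ← Real.rpow_natCast, ← Real.rpow_mul (norm_nonneg _),
      ← Real.rpow_mul (norm_nonneg _), mul_comm]
  rw [h3, ← mul_pow]
  have : 0 ≤ ‖x - y‖ ^ (α : ℝ) := by positivity
  exact pow_le_pow_left₀ (norm_nonneg _) (h.trans (by gcongr)) 2

theorem featureMatrix_apply {m p n' : ℕ} (φ : EuclideanSpace ℝ (Fin m) → EuclideanSpace ℝ (Fin p))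
    (x : Fin n' → EuclideanSpace ℝ (Fin (m + 1))) (a : EuclideanSpace ℝ (Fin p)) (i : Fin n') :
    Matrix.toEuclideanLin (featureMatrix φ x) a i = inner ℝ a (φ (firstEntries (x i))) := by
  rw [EuclideanSpace.inner_eq_star_dotProduct]
  simp only [Matrix.ofLp_toLpLin, Matrix.toLin'_apply, star_trivial]
  rfl

/-- The Frobenius norm of the difference of two feature matrices bounds its operator norm. -/
theorem norm_featureMatrix_sub_le {m p n' : ℕ}
    (φ : EuclideanSpace ℝ (Fin m) → EuclideanSpace ℝ (Fin p))
    (x y : Fin n' → EuclideanSpace ℝ (Fin (m + 1))) (a : EuclideanSpace ℝ (Fin p)) :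
    ‖Matrix.toEuclideanLin (featureMatrix φ x) a - Matrix.toEuclideanLin (featureMatrix φ y) a‖ ≤
      √(∑ i, ‖φ (firstEntries (x i)) - φ (firstEntries (y i))‖ ^ 2) * ‖a‖ := by
  refine le_of_sq_le_sq ?_ (by positivity)
  rw [EuclideanSpace.norm_sq_eq, mul_pow, Real.sq_sqrt (by positivity), Finset.sum_mul]
  refine Finset.sum_le_sum fun i _ => ?_
  rw [PiLp.sub_apply, featureMatrix_apply, featureMatrix_apply, ← inner_sub_right, ← mul_pow]
  refine pow_le_pow_left₀ (norm_nonneg _) ?_ 2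
  rw [mul_comm]
  exact norm_inner_le_norm _ _

theorem norm_target {m n' p : ℕ} (x : Fin n' → EuclideanSpace ℝ (Fin (m + 1))) :
    ‖target p x‖ = ‖WithLp.toLp 2 fun i => x i (Fin.last m)‖ := by
  rw [EuclideanSpace.norm_eq, EuclideanSpace.norm_eq]
  simp [target]

/-- Comparison of the bound obtained from the deterministic estimate with the stated one. Here `k`
stands for `√n'` and `r` for `n ^ (1 / (2 m + 3))`. The logarithmic term and the term with
`C ^ (2 / α)` outside the bracket only have to be nonnegative. -/
theorem le_firstMomentBound {m n n' : ℕ} (hn : 0 < n) (hn' : 0 < n') {α C ε εm σ U l : ℝ}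
    (hα₀ : 0 < α) (hα₁ : α ≤ 1) (hC : 0 ≤ C) (hε : 0 ≤ ε) (hεm : 0 ≤ εm) (hU : 0 ≤ U)
    (hl : 0 < l) (hlS : l < σ * √n') :
    εm ^ (1 / 2 : ℝ) * √n' / (n : ℝ) ^ (1 / (2 * m + 3) : ℝ) / (σ * √n') *
        (2 + C * √n' * (ε ^ (α / 2) / ((n : ℝ) ^ (1 / (2 * m + 3) : ℝ)) ^ α) / l) +
      U * √n' * (2 * l / (σ * √n') ^ 2 +
        6 * (C * √n' * (ε ^ (α / 2) / ((n : ℝ) ^ (1 / (2 * m + 3) : ℝ)) ^ α)) ^ 2 /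
          (l * (σ * √n') ^ 2)) ≤
      firstMomentBound m n n' α C ε εm σ U l := by
  have hn0 : (0 : ℝ) < n := by exact_mod_cast hn
  have hk : 0 < √(n' : ℝ) := Real.sqrt_pos.2 (by exact_mod_cast hn')
  have hσ : 0 < σ := by
    by_contra! h
    have := mul_nonpos_of_nonpos_of_nonneg h hk.le
    linarith
  unfold firstMomentBound
  have hr2 : (n : ℝ) ^ (2 / (2 * m + 3) : ℝ) = ((n : ℝ) ^ (1 / (2 * m + 3) : ℝ)) ^ 2 := by
    rw [← Real.rpow_natCast, ← Real.rpow_mul hn0.le]; congr 1; push_cast; ring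
  have hr2α : (n : ℝ) ^ (2 * α / (2 * m + 3) : ℝ) =
      (((n : ℝ) ^ (1 / (2 * m + 3) : ℝ)) ^ α) ^ 2 := by
    rw [← Real.rpow_natCast, ← Real.rpow_mul hn0.le, ← Real.rpow_mul hn0.le]
    congr 1; push_cast; ring
  have hεα : ε ^ α = (ε ^ (α / 2)) ^ 2 := by
    rw [← Real.rpow_natCast, ← Real.rpow_mul hε]; congr 1; push_cast; ring
  have hn'k : (n' : ℝ) ^ (1 / α) = √(n' : ℝ) ^ (2 / α) := by
    rw [Real.sqrt_eq_rpow, ← Real.rpow_mul (by positivity)]; congr 1; ring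
  rw [hr2, hr2α, hn'k, hεα]
  have hr : 0 < (n : ℝ) ^ (1 / (2 * m + 3) : ℝ) := by positivity
  set r := (n : ℝ) ^ (1 / (2 * m + 3) : ℝ)
  set k := √(n' : ℝ)
  set F := εm ^ (1 / 2 : ℝ)
  have hF : 0 ≤ F := by positivity
  have hE : 0 ≤ ε ^ (α / 2) := by positivity
  -- `G` is normalised so that `G ^ (α / 2)` is the root mean square bound of `δ / l`
  set G := C ^ (2 / α) * ε * k ^ (2 / α) / (l ^ (2 / α) * r ^ 2) with hG
  have hG0 : 0 ≤ G := by positivity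
  have hGα : G ^ (α / 2) = C * k * (ε ^ (α / 2) / r ^ α) / l := by
    have hp : ∀ t : ℝ, 0 ≤ t → (t ^ (2 / α)) ^ (α / 2) = t := by
      intro t ht
      rw [← Real.rpow_mul ht]
      have : 2 / α * (α / 2) = 1 := by field_simp
      rw [this, Real.rpow_one]
    have hr' : (r ^ 2) ^ (α / 2) = r ^ α := by
      rw [← Real.rpow_natCast, ← Real.rpow_mul hr.le]; congr 1; push_cast; ring
    rw [hG, Real.div_rpow (by positivity) (by positivity),
      Real.mul_rpow (by positivity) (by positivity), Real.mul_rpow (by positivity) hε,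
      Real.mul_rpow (by positivity) (by positivity), hp C hC, hp k hk.le, hp l hl.le, hr']
    ring
  have hin : C ^ (2 / α) * ε * k ^ (2 / α) / (l ^ (2 / α) * σ ^ (2 / α) * r ^ 2) +
      1 / σ ^ (2 / α) = (G + 1) / σ ^ (2 / α) := by
    rw [hG]
    have : 0 < σ ^ (2 / α) := by positivity
    have : 0 < l ^ (2 / α) := by positivity
    field_simp
  have hout : ((G + 1) / σ ^ (2 / α)) ^ (α / 2) = (G + 1) ^ (α / 2) / σ := by
    rw [Real.div_rpow (by positivity) (by positivity), ← Real.rpow_mul hσ.le]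
    have : 2 / α * (α / 2) = 1 := by field_simp
    rw [this, Real.rpow_one]
  rw [hin, hout, ← hGα]
  have h1 : 1 ≤ (G + 1) ^ (α / 2) := Real.one_le_rpow (by linarith) (by positivity)
  have h2 : G ^ (α / 2) ≤ (G + 1) ^ (α / 2) :=
    Real.rpow_le_rpow hG0 (by linarith) (by positivity)
  have h3 : (2 : ℝ) ≤ 2 ^ (2 - α / 2) := by
    calc (2 : ℝ) = 2 ^ (1 : ℝ) := (Real.rpow_one 2).symm
      _ ≤ _ := Real.rpow_le_rpow_of_exponent_le one_le_two (by linarith)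
  have h4 : F * k / r / (σ * k) * (2 + G ^ (α / 2)) ≤
      F / (σ * r) + 2 ^ (2 - α / 2) * F / r * ((G + 1) ^ (α / 2) / σ) := by
    have e1 : F * k / r / (σ * k) * (2 + G ^ (α / 2)) =
      F / (σ * r) + F / (σ * r) * (1 + G ^ (α / 2)) := by field_simp; ring
    have e2 : 2 ^ (2 - α / 2) * F / r * ((G + 1) ^ (α / 2) / σ) =
      F / (σ * r) * (2 ^ (2 - α / 2) * (G + 1) ^ (α / 2)) := by field_simp
    rw [e1, e2]
    have : 1 + G ^ (α / 2) ≤ 2 ^ (2 - α / 2) * (G + 1) ^ (α / 2) := by nlinarith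
    have := mul_le_mul_of_nonneg_left this (by positivity : 0 ≤ F / (σ * r))
    linarith
  have h5 : U * k * (2 * l / (σ * k) ^ 2 + 6 * (l * G ^ (α / 2)) ^ 2 / (l * (σ * k) ^ 2)) =
      2 * U * l / (σ ^ 2 * k) +
        6 * C ^ 2 * U * (ε ^ (α / 2)) ^ 2 / (r ^ α) ^ 2 * (k / (l * σ ^ 2)) := by
    rw [hGα]
    have : 0 < r ^ α := by positivity
    field_simp
  have h6 : l * G ^ (α / 2) = C * k * (ε ^ (α / 2) / r ^ α) := by rw [hGα]; field_simp
  have h7 : 0 ≤ 2 * U * l / (σ ^ 2 * k) := by positivity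
  have h8 : 4 * U * l / (σ ^ 2 * k) = 2 * U * l / (σ ^ 2 * k) + 2 * U * l / (σ ^ 2 * k) := by ring
  have h9 : 0 ≤ Real.log (σ * k / l) := Real.log_nonneg ((one_le_div hl).2 hlS.le)
  have h10 : 0 ≤ 6 * C ^ 2 * U * (ε ^ (α / 2)) ^ 2 / (r ^ α) ^ 2 *
    (2 * Real.log (σ * k / l) / σ ^ 3) := by positivity
  have h11 : 0 ≤ 4 * C ^ (2 / α) * U * ε * k / (l * σ ^ (2 / α) * r ^ 2) := by positivity
  rw [← h6, h5, h8, mul_add]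
  linarith

/-- The first moment bound for ridge regression with perturbed regressors and responses. -/
theorem integral_norm_ridgeEstimate_sub_le {Ω : Type*} [MeasurableSpace Ω] {μ : Measure Ω}
    [IsProbabilityMeasure μ] {m p n n' : ℕ} (hn : 0 < n) (hn' : 0 < n')
    {φ : EuclideanSpace ℝ (Fin m) → EuclideanSpace ℝ (Fin p)} {α C : ℝ≥0} (hα₀ : 0 < α)
    (hα₁ : α ≤ 1) (hφ : HolderWith C α φ) {θ : EuclideanSpace ℝ (Fin p)}
    {x : Fin n' → EuclideanSpace ℝ (Fin (m + 1))}
    (hlin : ∀ i, x i (Fin.last m) = inner ℝ θ (φ (firstEntries (x i))))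
    {xhat : Ω → Fin n' → EuclideanSpace ℝ (Fin (m + 1))}
    (hxhat : ∀ i, MemLp (fun ω => xhat ω i) 2 μ) {ε εm l : ℝ}
    (hε : ∫ ω, ∑ i, ‖xhat ω i - x i‖ ^ 2 ∂μ ≤ ε * n' * (n : ℝ) ^ (-(2 / (2 * m + 3)) : ℝ))
    (hεm : ∫ ω, ∑ i, (xhat ω i (Fin.last m) - x i (Fin.last m)) ^ 2 ∂μ
      ≤ εm * n' * (n : ℝ) ^ (-(2 / (2 * m + 3)) : ℝ))
    (hl : 0 < l) (hlS : l < sigmaMin (featureMatrix φ x)) :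
    Integrable (fun ω => ‖ridgeEstimate l φ (xhat ω) - θ‖) μ ∧
      ∫ ω, ‖ridgeEstimate l φ (xhat ω) - θ‖ ∂μ ≤
        firstMomentBound m n n' α C ε εm (sigmaMin (featureMatrix φ x) / √n')
          (‖target p x‖ / √n') l := by
  have hn0 : (0 : ℝ) < n := by exact_mod_cast hn
  have hn'0 : (0 : ℝ) < n' := by exact_mod_cast hn'
  have hk : 0 < √(n' : ℝ) := Real.sqrt_pos.2 hn'0
  have hα₀' : (0 : ℝ) < α := by exact_mod_cast hα₀
  have hα₁' : (α : ℝ) ≤ 1 := by exact_mod_cast hα₁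
  have hφc : Continuous φ := hφ.continuous hα₀
  have hk2 : √(n' : ℝ) ^ 2 = n' := Real.sq_sqrt hn'0.le
  set k := √(n' : ℝ)
  set S := sigmaMin (featureMatrix φ x) with hS
  have hS0 : 0 < S := hl.trans hlS
  set r := (n : ℝ) ^ (1 / (2 * m + 3) : ℝ) with hr
  have hr0 : 0 < r := by positivity
  have hr2 : (n : ℝ) ^ (-(2 / (2 * m + 3)) : ℝ) = 1 / r ^ 2 := by
    rw [Real.rpow_neg hn0.le, one_div, hr, ← Real.rpow_natCast, ← Real.rpow_mul hn0.le]
    congr 2; push_cast; ring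
  rw [hr2] at hε hεm
  -- both constants are nonnegative, because they bound second moments
  have hε0 : 0 ≤ ε := by
    have h : 0 ≤ ε * n' * (1 / r ^ 2) := le_trans (by positivity) hε
    by_contra! hneg
    have : 0 < -ε * n' * (1 / r ^ 2) := by have := neg_pos.2 hneg; positivity
    linarith
  have hεm0 : 0 ≤ εm := by
    have h : 0 ≤ εm * n' * (1 / r ^ 2) := le_trans (by positivity) hεm
    by_contra! hneg
    have : 0 < -εm * n' * (1 / r ^ 2) := by have := neg_pos.2 hneg; positivity
    linarith
  have hsub : ∀ i, MemLp (fun ω => xhat ω i - x i) 2 μ := fun i =>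
    (hxhat i).sub (memLp_const (x i))
  have hz : ∀ i, Integrable (fun ω => ‖xhat ω i - x i‖ ^ 2) μ := fun i =>
    (memLp_two_iff_integrable_sq_norm (hsub i).aestronglyMeasurable).1 (hsub i)
  -- the perturbation of the feature matrix
  set δ : Ω → ℝ := fun ω =>
    √(∑ i, ‖φ (firstEntries (xhat ω i)) - φ (firstEntries (x i))‖ ^ 2) with hδ
  have hδm : AEStronglyMeasurable δ μ := by
    refine Real.continuous_sqrt.comp_aestronglyMeasurable ?_
    refine Finset.aestronglyMeasurable_fun_sum _ fun i _ => ?_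
    refine ((Continuous.comp_aestronglyMeasurable (f := fun ω => xhat ω i)
      (g := fun y => φ (firstEntries y) - φ (firstEntries (x i))) ?_
      (hxhat i).aestronglyMeasurable).norm.pow 2)
    exact (hφc.comp continuous_firstEntries).sub continuous_const
  have hδsq : ∀ ω, δ ω ^ 2 ≤ C ^ 2 * ∑ i, (‖xhat ω i - x i‖ ^ 2) ^ (α : ℝ) := by
    intro ω
    rw [hδ, Real.sq_sqrt (by positivity), Finset.mul_sum]
    exact Finset.sum_le_sum fun i _ => sq_norm_feature_sub_le hφ _ _
  have hzα : Integrable (fun ω => (C : ℝ) ^ 2 * ∑ i, (‖xhat ω i - x i‖ ^ 2) ^ (α : ℝ)) μ :=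
    (integrable_finsetSum _ fun i _ =>
      integrable_rpow_of_le_one hα₀'.le hα₁' (fun ω => sq_nonneg _) (hz i)).const_mul _
  have hδi : Integrable (fun ω => δ ω ^ 2) μ := by
    refine hzα.mono' (hδm.pow 2) (.of_forall fun ω => ?_)
    rw [Real.norm_of_nonneg (sq_nonneg _)]
    exact hδsq ω
  have hδ2 : MemLp δ 2 μ := (memLp_two_iff_integrable_sq hδm).2 hδi
  set D := C * k * (ε ^ ((α : ℝ) / 2) / r ^ (α : ℝ)) with hD
  have hD0 : 0 ≤ D := by positivity
  have hδD : ∫ ω, δ ω ^ 2 ∂μ ≤ D ^ 2 := by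
    have h1 := integral_sum_rpow_le (μ := μ) (Y := ε / r ^ 2) hα₀' hα₁' (by positivity)
      (fun (i : Fin n') ω => sq_nonneg ‖xhat ω i - x i‖) hz
      (hε.trans_eq (by rw [Fintype.card_fin]; ring))
    have h2 : D ^ 2 = C ^ 2 * (n' * (ε / r ^ 2) ^ (α : ℝ)) := by
      have e1 : (ε / r ^ 2) ^ (α : ℝ) = (ε ^ ((α : ℝ) / 2) / r ^ (α : ℝ)) ^ 2 := by
        rw [Real.div_rpow hε0 (by positivity), div_pow]
        congr 1
        · rw [← Real.rpow_natCast, ← Real.rpow_mul hε0]; congr 1; push_cast; ring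
        · rw [← Real.rpow_natCast, ← Real.rpow_natCast, ← Real.rpow_mul hr0.le,
            ← Real.rpow_mul hr0.le, mul_comm]
      rw [e1, hD, mul_pow, mul_pow, hk2, mul_assoc]
    rw [h2]
    refine (integral_mono hδi hzα hδsq).trans ?_
    rw [integral_const_mul]
    rw [Fintype.card_fin] at h1
    gcongr
  -- the perturbation of the responses
  set v : EuclideanSpace ℝ (Fin n') := WithLp.toLp 2 fun i => x i (Fin.last m) with hv
  set f : Ω → ℝ := fun ω => ‖(WithLp.toLp 2 fun i => xhat ω i (Fin.last m)) - v‖ with hf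
  have hfsq : ∀ ω, f ω ^ 2 = ∑ i, (xhat ω i (Fin.last m) - x i (Fin.last m)) ^ 2 := by
    intro ω
    rw [hf, EuclideanSpace.norm_sq_eq]
    simp [hv]
  have hfi1 : ∀ i, MemLp (fun ω => xhat ω i (Fin.last m) - x i (Fin.last m)) 2 μ := by
    intro i
    refine (hsub i).mono ?_ (.of_forall fun ω => ?_)
    · exact ((EuclideanSpace.proj (𝕜 := ℝ) (Fin.last m)).continuous.comp_aestronglyMeasurable
        (hsub i).aestronglyMeasurable)
    · exact PiLp.norm_apply_le (xhat ω i - x i) (Fin.last m)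
  have hfi : Integrable (fun ω => f ω ^ 2) μ := by
    simp only [hfsq]
    exact integrable_finsetSum _ fun i _ => (hfi1 i).integrable_sq
  have hfm : AEStronglyMeasurable f μ := by
    have : f = fun ω => √(f ω ^ 2) := by
      funext ω; rw [Real.sqrt_sq (norm_nonneg _)]
    rw [this]
    exact Real.continuous_sqrt.comp_aestronglyMeasurable hfi.aestronglyMeasurable
  have hf2 : MemLp f 2 μ := (memLp_two_iff_integrable_sq hfm).2 hfi
  set F := εm ^ (1 / 2 : ℝ) * k / r with hF
  have hF0 : 0 ≤ F := by positivity
  have hfF : ∫ ω, f ω ^ 2 ∂μ ≤ F ^ 2 := by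
    have h2 : F ^ 2 = εm * n' * (1 / r ^ 2) := by
      rw [hF, div_pow, mul_pow, hk2, ← Real.sqrt_eq_rpow, Real.sq_sqrt hεm0]; ring
    simp only [hfsq]
    rw [h2]; exact hεm
  -- the deterministic estimate, for each outcome
  have hLθ : Matrix.toEuclideanLin (featureMatrix φ x) θ = v := by
    ext i
    rw [featureMatrix_apply, hv]
    exact (hlin i).symm
  set V := ‖target p x‖ with hV
  have hVv : V = ‖v‖ := norm_target x
  have hdet : ∀ ω, ‖ridgeEstimate l φ (xhat ω) - θ‖ ≤
      f ω / S * (2 + δ ω / l) + V * (2 * l / S ^ 2 + 6 * δ ω ^ 2 / (l * S ^ 2)) := by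
    intro ω
    have := norm_sub_le_of_normal_eq (θ := θ) hl hlS (Real.sqrt_nonneg _)
      (sigmaMin_mul_norm_le (featureMatrix φ x)) (norm_featureMatrix_sub_le φ (xhat ω) x)
      (ridgeEstimate_inner_eq l φ (xhat ω))
    rwa [hLθ, ← hVv] at this
  have hfδ : Integrable (fun ω => f ω * δ ω) μ := hf2.integrable_mul hδ2
  have hf1 : Integrable f μ := hf2.integrable one_le_two
  have heq : ∀ ω, f ω / S * (2 + δ ω / l) + V * (2 * l / S ^ 2 + 6 * δ ω ^ 2 / (l * S ^ 2)) =
      2 / S * f ω + 1 / (S * l) * (f ω * δ ω) + (V * (2 * l / S ^ 2) +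
        V * 6 / (l * S ^ 2) * δ ω ^ 2) := by
    intro ω; field_simp
  have hi1 := hf1.const_mul (2 / S)
  have hi2 := hfδ.const_mul (1 / (S * l))
  have hi12 : Integrable (fun ω => 2 / S * f ω + 1 / (S * l) * (f ω * δ ω)) μ := hi1.add hi2
  have hi3 := integrable_const (μ := μ) (V * (2 * l / S ^ 2))
  have hi4 := hδi.const_mul (V * 6 / (l * S ^ 2))
  have hi34 : Integrable (fun ω => V * (2 * l / S ^ 2) + V * 6 / (l * S ^ 2) * δ ω ^ 2) μ :=
    hi3.add hi4
  have hdom : Integrable (fun ω => f ω / S * (2 + δ ω / l) +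
      V * (2 * l / S ^ 2 + 6 * δ ω ^ 2 / (l * S ^ 2))) μ := by
    simp only [heq]
    exact hi12.add hi34
  have hrm : AEStronglyMeasurable (fun ω => ‖ridgeEstimate l φ (xhat ω) - θ‖) μ := by
    have h1 : AEStronglyMeasurable (fun ω => xhat ω) μ :=
      (aemeasurable_pi_lambda _ fun i =>
        (hxhat i).aestronglyMeasurable.aemeasurable).aestronglyMeasurable
    exact (((continuous_ridgeEstimate hl.ne' hφc).comp_aestronglyMeasurable h1).sub
      aestronglyMeasurable_const).norm
  have hint : Integrable (fun ω => ‖ridgeEstimate l φ (xhat ω) - θ‖) μ :=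
    hdom.mono' hrm (.of_forall fun ω => by rw [norm_norm]; exact hdet ω)
  refine ⟨hint, ?_⟩
  have hfδD := integral_mul_le_of_integral_sq_le (fun ω => norm_nonneg _)
    (fun ω => Real.sqrt_nonneg _) hf2 hδ2 hF0 hD0 hfF hδD
  have hfF1 : ∫ ω, f ω ∂μ ≤ F := by
    have := integral_mul_le_of_integral_sq_le (μ := μ) (f := f) (g := fun _ => 1)
      (fun ω => norm_nonneg _) (fun ω => zero_le_one) hf2 (memLp_const 1) hF0 zero_le_one hfF
      (by simp)
    simpa using this
  have hVnn : 0 ≤ V := norm_nonneg _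
  calc ∫ ω, ‖ridgeEstimate l φ (xhat ω) - θ‖ ∂μ
      ≤ ∫ ω, (2 / S * f ω + 1 / (S * l) * (f ω * δ ω) + (V * (2 * l / S ^ 2) +
        V * 6 / (l * S ^ 2) * δ ω ^ 2)) ∂μ := by
        refine integral_mono hint (hi12.add hi34) fun ω => ?_
        exact (hdet ω).trans_eq (heq ω)
    _ = 2 / S * ∫ ω, f ω ∂μ + 1 / (S * l) * ∫ ω, f ω * δ ω ∂μ + (V * (2 * l / S ^ 2) +
        V * 6 / (l * S ^ 2) * ∫ ω, δ ω ^ 2 ∂μ) := by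
        rw [integral_add hi12 hi34, integral_add hi1 hi2, integral_add hi3 hi4,
          integral_const_mul (2 / S), integral_const_mul (1 / (S * l)),
          integral_const_mul (V * 6 / _)]
        simp
    _ ≤ 2 / S * F + 1 / (S * l) * (F * D) + (V * (2 * l / S ^ 2) +
        V * 6 / (l * S ^ 2) * D ^ 2) := by gcongr
    _ = F / (S / k * k) * (2 + D / l) +
        V / k * k * (2 * l / (S / k * k) ^ 2 + 6 * D ^ 2 / (l * (S / k * k) ^ 2)) := by
        rw [div_mul_cancel₀ S hk.ne', div_mul_cancel₀ V hk.ne']; field_simp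
    _ ≤ _ := le_firstMomentBound hn hn' hα₀' hα₁' C.2 hε0 hεm0 (by positivity) hl
        (by rw [div_mul_cancel₀ S hk.ne']; exact hlS)

/-! ### Orthogonal polynomials on a grid -/

theorem discreteInner_add_right (ρ : ℝ → ℝ) (N : ℕ) (f g h : ℝ[X]) :
    discreteInner ρ N f (g + h) = discreteInner ρ N f g + discreteInner ρ N f h := by
  simp only [discreteInner, Polynomial.eval_add, mul_add, Finset.sum_add_distrib]

theorem discreteInner_C_mul_right (ρ : ℝ → ℝ) (N : ℕ) (f g : ℝ[X]) (c : ℝ) :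
    discreteInner ρ N f (Polynomial.C c * g) = c * discreteInner ρ N f g := by
  simp only [discreteInner, Polynomial.eval_mul, Polynomial.eval_C, Finset.mul_sum]
  exact Finset.sum_congr rfl fun j _ => by ring

theorem discreteInner_X_pow (ρ : ℝ → ℝ) (N : ℕ) (f : ℝ[X]) (k : ℕ) :
    discreteInner ρ N f (Polynomial.X ^ k) = (1 / (N : ℝ)) * ∑ j ∈ Finset.Icc 1 N,
      ρ ((j : ℝ) / N) * f.eval ((j : ℝ) / N) * ((j : ℝ) / N) ^ k := by
  simp only [discreteInner, Polynomial.eval_pow, Polynomial.eval_X]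

theorem filterH_eq_discreteInner (ρ : ℝ → ℝ) (N : ℕ) (P : ℕ → ℝ[X]) (d : ℕ) :
    filterH ρ N P d = discreteInner ρ N (P d) (Polynomial.X ^ d) := by
  rw [discreteInner_X_pow]; rfl

/-- Removing from `q` its component along `r`, where `deg r = e` and `deg q ≤ e`, lowers the
degree. -/
theorem exists_eq_C_mul_add_of_degree_lt_succ {q r : ℝ[X]} {e : ℕ} (hr : r.degree = e)
    (hq : q.degree < ((e + 1 : ℕ) : WithBot ℕ)) :
    ∃ q' : ℝ[X], q'.degree < (e : WithBot ℕ) ∧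
      q = Polynomial.C (q.coeff e / r.coeff e) * r + q' := by
  refine ⟨q - Polynomial.C (q.coeff e / r.coeff e) * r, ?_, by ring⟩
  rw [Polynomial.degree_lt_iff_coeff_zero] at hq ⊢
  intro k hk
  have hre : r.coeff e ≠ 0 := Polynomial.coeff_ne_zero_of_eq_degree hr
  rw [Polynomial.coeff_sub, Polynomial.coeff_C_mul]
  rcases hk.eq_or_lt with rfl | hlt
  · rw [div_mul_cancel₀ _ hre, sub_self]
  · have hrk : r.coeff k = 0 := by
      refine Polynomial.coeff_eq_zero_of_degree_lt ?_
      rw [hr]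
      exact_mod_cast hlt
    rw [hq k hlt, hrk, mul_zero, sub_zero]

/-- `P d` is orthogonal to every polynomial of smaller degree. -/
theorem IsOrthogonalFamily.discreteInner_eq_zero {ρ : ℝ → ℝ} {N : ℕ} {P : ℕ → ℝ[X]}
    (hP : IsOrthogonalFamily ρ N P) {d : ℕ} (hd : d < N) {e : ℕ} (he : e ≤ d) {q : ℝ[X]}
    (hq : q.degree < (e : WithBot ℕ)) : discreteInner ρ N (P d) q = 0 := by
  induction e generalizing q with
  | zero =>
    have : q = 0 := by
      by_contra h
      rw [Polynomial.degree_eq_natDegree h] at hq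
      exact absurd hq (by simp)
    simp [this, discreteInner]
  | succ e ih =>
    obtain ⟨q', hq', h⟩ := exists_eq_C_mul_add_of_degree_lt_succ (hP.degree_eq e (by omega)) hq
    rw [h, discreteInner_add_right, discreteInner_C_mul_right,
      hP.orthogonal d hd e (by omega) (by omega), ih (by omega) hq']
    simp

theorem IsOrthogonalFamily.discreteInner_self_pos {ρ : ℝ → ℝ}
    (hρ : ∀ t ∈ Set.Icc (0 : ℝ) 1, 0 < ρ t)
    {N : ℕ} {P : ℕ → ℝ[X]} (hP : IsOrthogonalFamily ρ N P) {d : ℕ} (hd : d < N) :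
    0 < discreteInner ρ N (P d) (P d) := by
  have hN : (0 : ℝ) < N := by exact_mod_cast (Nat.zero_le d).trans_lt hd
  have hpos : ∀ j ∈ Finset.Icc 1 N, 0 < ρ ((j : ℝ) / N) := by
    intro j hj
    have hjN : (j : ℝ) ≤ N := by exact_mod_cast (Finset.mem_Icc.1 hj).2
    exact hρ _ ⟨by positivity, (div_le_one hN).2 hjN⟩
  refine mul_pos (by positivity) ?_
  have hnn : ∀ j ∈ Finset.Icc 1 N, 0 ≤
      ρ ((j : ℝ) / N) * (P d).eval ((j : ℝ) / N) * (P d).eval ((j : ℝ) / N) := by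
    intro j hj
    rw [mul_assoc]
    exact mul_nonneg (hpos j hj).le (mul_self_nonneg _)
  refine (Finset.sum_nonneg hnn).lt_of_ne' fun h0 => ?_
  rw [Finset.sum_eq_zero_iff_of_nonneg hnn] at h0
  -- otherwise a polynomial of degree `d < N` vanishes at all `N` grid points
  have hz : P d = 0 := by
    refine Polynomial.eq_zero_of_degree_lt_of_eval_index_eq_zero (s := Finset.Icc 1 N)
      (v := fun j : ℕ => (j : ℝ) / N) ?_ ?_ ?_
    · intro i _ j _ hij
      simpa [hN.ne'] using hij
    · rw [hP.degree_eq d hd]; simpa using hd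
    · intro j hj
      have := h0 j hj
      rw [mul_assoc] at this
      exact mul_self_eq_zero.1 ((mul_eq_zero.1 this).resolve_left (hpos j hj).ne')
  have := hP.degree_eq d hd
  rw [hz, Polynomial.degree_zero] at this
  exact absurd this (by simp)

/-- The filter may divide by `h^d`: the positive number `⟨P d, P d⟩` is `h^d` times the leading
coefficient of `P d`. -/
theorem IsOrthogonalFamily.filterH_ne_zero {ρ : ℝ → ℝ} (hρ : ∀ t ∈ Set.Icc (0 : ℝ) 1, 0 < ρ t)
    {N : ℕ} {P : ℕ → ℝ[X]} (hP : IsOrthogonalFamily ρ N P) {d : ℕ} (hd : d < N) :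
    filterH ρ N P d ≠ 0 := by
  intro h0
  rw [filterH_eq_discreteInner] at h0
  obtain ⟨q', hq', h⟩ := exists_eq_C_mul_add_of_degree_lt_succ (q := P d) (e := d)
    (Polynomial.degree_X_pow (R := ℝ) d) (by rw [hP.degree_eq d hd]; exact_mod_cast d.lt_succ_self)
  have hpos := hP.discreteInner_self_pos hρ hd
  rw [congrArg (discreteInner ρ N (P d)) h, discreteInner_add_right, discreteInner_C_mul_right, h0,
    hP.discreteInner_eq_zero hd le_rfl hq'] at hpos
  simp at hpos

/-! ### Bias of the differentiation filter -/

/-- Taylor's theorem for a chain `F 0, F 1, …` of successive derivatives on an interval; no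
continuity of the last derivative is assumed. -/
theorem abs_sub_taylor_le {a b M : ℝ} {e : ℕ} {F : ℕ → ℝ → ℝ}
    (hF : ∀ k ≤ e, ∀ t ∈ Set.Icc a b, HasDerivWithinAt (F k) (F (k + 1) t) (Set.Icc a b) t)
    (hM : ∀ t ∈ Set.Icc a b, |F (e + 1) t| ≤ M) {t : ℝ} (ht : t ∈ Set.Icc a b) :
    |F 0 t - ∑ i ∈ Finset.range (e + 1), F i a * (t - a) ^ i / (i.factorial : ℝ)| ≤
      M * (t - a) ^ (e + 1) / ((e + 1).factorial : ℝ) := by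
  induction e generalizing F t with
  | zero =>
    have h := Convex.norm_image_sub_le_of_norm_hasDerivWithin_le (f := F 0) (f' := F 1)
      (fun s hs => hF 0 le_rfl s hs) (fun s hs => hM s hs) (convex_Icc a b)
      (Set.left_mem_Icc.2 (ht.1.trans ht.2)) ht
    rw [Real.norm_eq_abs, Real.norm_eq_abs, abs_of_nonneg (sub_nonneg.2 ht.1)] at h
    simpa using h
  | succ e ih =>
    set R : ℝ → ℝ := fun t =>
      F 0 t - ∑ i ∈ Finset.range (e + 1 + 1), F i a * (t - a) ^ i / (i.factorial : ℝ) with hR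
    set R' : ℝ → ℝ := fun t =>
      F 1 t - ∑ i ∈ Finset.range (e + 1), F (i + 1) a * (t - a) ^ i / (i.factorial : ℝ) with hR'
    have hder : ∀ t ∈ Set.Icc a b, HasDerivWithinAt R (R' t) (Set.Icc a b) t := by
      intro t ht
      refine (hF 0 (Nat.zero_le _) t ht).sub ?_
      have h1 : ∀ i ∈ Finset.range (e + 1 + 1), HasDerivWithinAt
          (fun t => F i a * (t - a) ^ i / (i.factorial : ℝ))
          (F i a * (i * (t - a) ^ (i - 1)) / (i.factorial : ℝ)) (Set.Icc a b) t := by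
        intro i _
        have := (((hasDerivAt_id t).sub_const a).pow i).const_mul (F i a)
        simpa using (this.div_const (i.factorial : ℝ)).hasDerivWithinAt
      have h2 := HasDerivWithinAt.fun_sum h1
      convert h2 using 1
      rw [Finset.sum_range_succ' _ (e + 1)]
      simp only [Nat.cast_zero, zero_mul, mul_zero, zero_div, add_zero, Nat.add_sub_cancel]
      refine Finset.sum_congr rfl fun i _ => ?_
      rw [Nat.factorial_succ]
      have : (i.factorial : ℝ) ≠ 0 := by exact_mod_cast i.factorial_ne_zero
      push_cast
      field_simp
    have hbound : ∀ t ∈ Set.Icc a b, |R' t| ≤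
        M * (t - a) ^ (e + 1) / ((e + 1).factorial : ℝ) := fun t ht =>
      ih (F := fun k => F (k + 1)) (fun k hk s hs => hF (k + 1) (by omega) s hs) hM ht
    have hB : ∀ t, HasDerivAt
        (fun t => M * (t - a) ^ (e + 1 + 1) / ((e + 1 + 1).factorial : ℝ))
        (M * (t - a) ^ (e + 1) / ((e + 1).factorial : ℝ)) t := by
      intro t
      have := ((((hasDerivAt_id t).sub_const a).pow (e + 1 + 1)).const_mul M).div_const
        ((e + 1 + 1).factorial : ℝ)
      refine this.congr_deriv ?_
      rw [Nat.factorial_succ (e + 1)]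
      have : ((e + 1).factorial : ℝ) ≠ 0 := by exact_mod_cast (e + 1).factorial_ne_zero
      simp only [Nat.add_sub_cancel, mul_one, id]
      push_cast
      field_simp
    have hR0 : ‖R a‖ ≤ M * (a - a) ^ (e + 1 + 1) / ((e + 1 + 1).factorial : ℝ) := by
      rw [hR]
      simp [Finset.sum_range_succ']
    exact image_norm_le_of_norm_deriv_right_le_deriv_boundary
      (fun s hs => (hder s hs).continuousWithinAt)
      (fun s hs => (hder s (Set.Ico_subset_Icc_self hs)).mono_of_mem_nhdsWithin
        (Icc_mem_nhdsGE_of_mem hs)) hR0 hB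
      (fun s hs => hbound s (Set.Ico_subset_Icc_self hs)) ht

theorem hasDerivWithinAt_timeDeriv {T : ℝ} {y : ℝ → ℝ} {k : ℕ}
    (hy : DifferentiableOn ℝ (timeDeriv T y k) (Set.Icc 0 T)) {t : ℝ} (ht : t ∈ Set.Icc 0 T) :
    HasDerivWithinAt (timeDeriv T y k) (timeDeriv T y (k + 1) t) (Set.Icc 0 T) t := by
  have h := (hy t ht).hasDerivWithinAt
  have hsucc : timeDeriv T y (k + 1) t = derivWithin (timeDeriv T y k) (Set.Icc 0 T) t := by
    rw [timeDeriv, iteratedDerivWithin_succ]; rfl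
  rwa [hsucc]

theorem sampleTime_add (T : ℝ) (n a j : ℕ) :
    sampleTime T n (a + j) = sampleTime T n a + j * T / n := by
  simp only [sampleTime]; push_cast; ring

theorem sampleTime_mem_Icc {T : ℝ} (hT : 0 ≤ T) {n j : ℕ} (hj : j ≤ n) :
    sampleTime T n j ∈ Set.Icc 0 T := by
  refine ⟨by unfold sampleTime; positivity, ?_⟩
  unfold sampleTime
  have hjn : (j : ℝ) ≤ n := by exact_mod_cast hj
  exact div_le_of_le_mul₀ (by positivity) hT (by rw [mul_comm]; gcongr)

/-- On noiseless data the filter reproduces the Taylor polynomial of degree `d` exactly, by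
orthogonality, so that only the Taylor remainder contributes to the error. -/
theorem abs_derivEstimate_sub_le {T : ℝ} (hT : 0 < T) {y : ℝ → ℝ} {ρ : ℝ → ℝ}
    (hρ : ∀ t ∈ Set.Icc (0 : ℝ) 1, 0 < ρ t) {n N a d : ℕ} {P : ℕ → ℝ[X]}
    (hP : IsOrthogonalFamily ρ N P) (ha : a + N ≤ n) (hd : d < N)
    (hy : ∀ k ≤ d, DifferentiableOn ℝ (timeDeriv T y k) (Set.Icc 0 T))
    (hb : BddAbove ((fun t => |timeDeriv T y (d + 1) t|) '' Set.Icc 0 T)) :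
    |derivEstimate T n N ρ P (fun j => y (sampleTime T n j)) a d -
        timeDeriv T y d (sampleTime T n a)| ≤
      windowSup T n N y a d * T / (d + 1) * (filterG ρ N P d / |filterH ρ N P d|) * (N / n) := by
  have hNnat : 0 < N := (Nat.zero_le d).trans_lt hd
  have hN : (0 : ℝ) < N := by exact_mod_cast hNnat
  have hn : (0 : ℝ) < n := by exact_mod_cast (by omega : 0 < n)
  have hh : filterH ρ N P d ≠ 0 := hP.filterH_ne_zero hρ hd
  set h := filterH ρ N P d with hhdef
  set M := windowSup T n N y a d with hM
  set a' := sampleTime T n a with ha'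
  set b' := a' + N * T / n with hb'
  have hsub : Set.Icc a' b' ⊆ Set.Icc 0 T := by
    refine Set.Icc_subset_Icc (sampleTime_mem_Icc hT.le (by omega : a ≤ n)).1 ?_
    rw [hb', ha', ← sampleTime_add]
    exact (sampleTime_mem_Icc hT.le ha).2
  have hMle : ∀ t ∈ Set.Icc a' b', |timeDeriv T y (d + 1) t| ≤ M := fun t ht =>
    le_csSup (hb.mono (Set.image_mono hsub)) ⟨t, ht, rfl⟩
  have hM0 : 0 ≤ M := (abs_nonneg _).trans
    (hMle a' (Set.left_mem_Icc.2 (by rw [hb']; have : 0 ≤ N * T / n := by positivity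
                                     linarith)))
  set c : ℕ → ℝ := fun j => ρ ((j : ℝ) / N) * (P d).eval ((j : ℝ) / N) with hc
  set R : ℕ → ℝ := fun j => y (sampleTime T n (a + j)) -
    ∑ i ∈ Finset.range (d + 1), timeDeriv T y i a' * (j * T / n) ^ i / (i.factorial : ℝ) with hR
  have hRle : ∀ j ∈ Finset.Icc 1 N, |R j| ≤
      M * (N * T / n) ^ (d + 1) / ((d + 1).factorial : ℝ) := by
    intro j hj
    have hjN : (j : ℝ) ≤ N := by exact_mod_cast (Finset.mem_Icc.1 hj).2
    have ht : a' + j * T / n ∈ Set.Icc a' b' :=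
      ⟨le_add_of_nonneg_right (by positivity), by rw [hb']; gcongr⟩
    have := abs_sub_taylor_le (F := timeDeriv T y) (e := d)
      (fun k hk t ht => (hasDerivWithinAt_timeDeriv (hy k hk) (hsub ht)).mono hsub) hMle ht
    rw [add_sub_cancel_left] at this
    have h0 : timeDeriv T y 0 (a' + j * T / n) = y (sampleTime T n (a + j)) := by
      rw [sampleTime_add]; exact congrFun iteratedDerivWithin_zero _
    rw [h0] at this
    exact this.trans (by gcongr)
  set K := (d.factorial : ℝ) * (n : ℝ) ^ d / ((N : ℝ) ^ (d + 1) * T ^ d * h) with hK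
  -- the `i`-th Taylor term is a multiple of the `i`-th moment of `P d`, which vanishes for `i < d`
  have hmom : ∀ i ∈ Finset.range (d + 1),
      ∑ j ∈ Finset.Icc 1 N, c j * (timeDeriv T y i a' * (j * T / n) ^ i / (i.factorial : ℝ)) =
      timeDeriv T y i a' * (N * T / n) ^ i / (i.factorial : ℝ) *
        (N * discreteInner ρ N (P d) (Polynomial.X ^ i)) := by
    intro i _
    rw [discreteInner_X_pow, ← mul_assoc (N : ℝ), mul_one_div_cancel hN.ne', one_mul,
      Finset.mul_sum]
    refine Finset.sum_congr rfl fun j _ => ?_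
    have : (j * T / n : ℝ) ^ i = (N * T / n) ^ i * ((j : ℝ) / N) ^ i := by
      rw [← mul_pow]; congr 1; field_simp
    rw [this]; simp only [hc]; ring
  have hpoly : K * ∑ j ∈ Finset.Icc 1 N, c j * ∑ i ∈ Finset.range (d + 1),
      timeDeriv T y i a' * (j * T / n) ^ i / (i.factorial : ℝ) = timeDeriv T y d a' := by
    simp only [Finset.mul_sum (Finset.range (d + 1))]
    rw [Finset.sum_comm, Finset.sum_congr rfl hmom, Finset.sum_range_succ, Finset.sum_eq_zero,
      zero_add, ← filterH_eq_discreteInner, ← hhdef, hK]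
    · have : (d.factorial : ℝ) ≠ 0 := by exact_mod_cast d.factorial_ne_zero
      rw [div_pow, mul_pow]
      field_simp
      ring
    · intro i hi
      rw [hP.discreteInner_eq_zero hd le_rfl]
      · simp
      · rw [Polynomial.degree_X_pow]; exact_mod_cast Finset.mem_range.1 hi
  have herr : derivEstimate T n N ρ P (fun j => y (sampleTime T n j)) a d - timeDeriv T y d a' =
      K * ∑ j ∈ Finset.Icc 1 N, c j * R j := by
    have hest : derivEstimate T n N ρ P (fun j => y (sampleTime T n j)) a d =
        K * ∑ j ∈ Finset.Icc 1 N, c j * y (sampleTime T n (a + j)) := rfl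
    rw [hest, ← hpoly, ← mul_sub, ← Finset.sum_sub_distrib]
    simp only [hR, mul_sub]
  have hρpos : ∀ j ∈ Finset.Icc 1 N, 0 ≤ ρ ((j : ℝ) / N) := by
    intro j hj
    have hjN : (j : ℝ) ≤ N := by exact_mod_cast (Finset.mem_Icc.1 hj).2
    exact (hρ _ ⟨by positivity, (div_le_one hN).2 hjN⟩).le
  have hsum : |∑ j ∈ Finset.Icc 1 N, c j * R j| ≤
      N * filterG ρ N P d * (M * (N * T / n) ^ (d + 1) / ((d + 1).factorial : ℝ)) := by
    refine (Finset.abs_sum_le_sum_abs _ _).trans ?_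
    rw [filterG, ← mul_assoc (N : ℝ), mul_one_div_cancel hN.ne', one_mul, Finset.sum_mul]
    refine Finset.sum_le_sum fun j hj => ?_
    rw [abs_mul, hc, abs_mul, abs_of_nonneg (hρpos j hj)]
    have := hρpos j hj
    have := hRle j hj
    gcongr
  rw [herr, abs_mul]
  refine (mul_le_mul_of_nonneg_left hsum (abs_nonneg K)).trans_eq ?_
  have hKabs : |K| = (d.factorial : ℝ) * (n : ℝ) ^ d / ((N : ℝ) ^ (d + 1) * T ^ d * |h|) := by
    rw [hK, abs_div, abs_mul ((N : ℝ) ^ (d + 1) * T ^ d), abs_of_nonneg (by positivity),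
      abs_of_nonneg (by positivity : (0 : ℝ) ≤ (N : ℝ) ^ (d + 1) * T ^ d)]
  have hh' : |h| ≠ 0 := abs_ne_zero.2 hh
  rw [hKabs, Nat.factorial_succ]
  have : (d.factorial : ℝ) ≠ 0 := by exact_mod_cast d.factorial_ne_zero
  push_cast
  rw [div_pow, mul_pow]
  field_simp
  ring

/-! ### Second moment of the filter error -/

theorem integral_sq_sum_of_uncorrelated {Ω : Type*} [MeasurableSpace Ω] {μ : Measure Ω}
    [IsProbabilityMeasure μ] {ι : Type*} {s : Finset ι} {X : ι → Ω → ℝ} (c : ι → ℝ)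
    (hX : ∀ i ∈ s, MemLp (X i) 2 μ) (h0 : ∀ i ∈ s, ∫ ω, X i ω ∂μ = 0)
    (hcov : ∀ i ∈ s, ∀ j ∈ s, i ≠ j → cov[X i, X j; μ] = 0) :
    ∫ ω, (∑ i ∈ s, c i * X i ω) ^ 2 ∂μ = ∑ i ∈ s, c i ^ 2 * Var[X i; μ] := by
  have hL : ∀ i ∈ s, MemLp (fun ω => c i * X i ω) 2 μ := fun i hi => (hX i hi).const_mul (c i)
  have hmean : ∫ ω, ∑ i ∈ s, c i * X i ω ∂μ = 0 := by
    rw [integral_finsetSum _ fun i hi => (hL i hi).integrable one_le_two]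
    refine Finset.sum_eq_zero fun i hi => ?_
    rw [integral_const_mul, h0 i hi, mul_zero]
  rw [← variance_of_integral_eq_zero (memLp_finsetSum _ hL).aemeasurable hmean,
    ← covariance_self (memLp_finsetSum _ hL).aemeasurable, covariance_fun_sum_fun_sum' hL hL]
  refine Finset.sum_congr rfl fun i hi => ?_
  rw [Finset.sum_eq_single_of_mem i hi]
  · rw [covariance_const_mul_left, covariance_const_mul_right,
      covariance_self (hX i hi).aemeasurable]
    ring
  · intro j hj hji
    rw [covariance_const_mul_left, covariance_const_mul_right, hcov i hi j hj hji.symm]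
    simp

theorem derivEstimate_observation {Ω : Type*} (T : ℝ) (n N : ℕ) (ρ : ℝ → ℝ) (P : ℕ → ℝ[X])
    (y : ℝ → ℝ) (w : ℝ → Ω → ℝ) (ω : Ω) (a d : ℕ) :
    derivEstimate T n N ρ P (observation T n y w ω) a d =
      derivEstimate T n N ρ P (fun j => y (sampleTime T n j)) a d +
        derivEstimate T n N ρ P (fun j => w (sampleTime T n j) ω) a d := by
  simp only [derivEstimate, observation, mul_add, Finset.sum_add_distrib]

theorem memLp_derivEstimate_noise {Ω : Type*} [MeasurableSpace Ω] {μ : Measure Ω}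
    {T : ℝ} (hT : 0 ≤ T) {w : ℝ → Ω → ℝ}
    (hw : ∀ t ∈ Set.Icc 0 T, MemLp (w t) 2 μ) {n N a : ℕ} (ha : a + N ≤ n) (ρ : ℝ → ℝ)
    (P : ℕ → ℝ[X]) (d : ℕ) :
    MemLp (fun ω => derivEstimate T n N ρ P (fun j => w (sampleTime T n j) ω) a d) 2 μ := by
  have hsum : MemLp (fun ω => ∑ j ∈ Finset.Icc 1 N,
      ρ ((j : ℝ) / N) * (P d).eval ((j : ℝ) / N) * w (sampleTime T n (a + j)) ω) 2 μ := by
    refine memLp_finsetSum _ fun j hj => ?_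
    have hj' : a + j ≤ n := by have := (Finset.mem_Icc.1 hj).2; omega
    exact (hw _ (sampleTime_mem_Icc hT hj')).const_mul
      (ρ ((j : ℝ) / N) * (P d).eval ((j : ℝ) / N))
  exact hsum.const_mul
    ((d.factorial : ℝ) * (n : ℝ) ^ d / ((N : ℝ) ^ (d + 1) * T ^ d * filterH ρ N P d))

theorem integral_derivEstimate_noise {Ω : Type*} [MeasurableSpace Ω] {μ : Measure Ω}
    [IsProbabilityMeasure μ] {T : ℝ} (hT : 0 ≤ T) {w : ℝ → Ω → ℝ}
    (hw : ∀ t ∈ Set.Icc 0 T, MemLp (w t) 2 μ) {n N a : ℕ} (ha : a + N ≤ n)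
    (h0 : ∀ j ∈ Finset.Icc 1 n, ∫ ω, w (sampleTime T n j) ω ∂μ = 0) (ρ : ℝ → ℝ)
    (P : ℕ → ℝ[X]) (d : ℕ) :
    ∫ ω, derivEstimate T n N ρ P (fun j => w (sampleTime T n j) ω) a d ∂μ = 0 := by
  unfold derivEstimate
  have hle : ∀ j ∈ Finset.Icc 1 N, a + j ∈ Finset.Icc 1 n := by
    intro j hj
    rw [Finset.mem_Icc] at hj ⊢
    omega
  rw [integral_const_mul, integral_finsetSum]
  · rw [Finset.sum_eq_zero, mul_zero]
    intro j hj
    rw [integral_const_mul, h0 _ (hle j hj), mul_zero]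
  · intro j hj
    exact ((hw _ (sampleTime_mem_Icc hT (Finset.mem_Icc.1 (hle j hj)).2)).integrable
      one_le_two).const_mul _

theorem integral_derivEstimate_noise_sq {Ω : Type*} [MeasurableSpace Ω] {μ : Measure Ω}
    [IsProbabilityMeasure μ] {T : ℝ} (hT : 0 < T) {w : ℝ → Ω → ℝ}
    (hw : ∀ t ∈ Set.Icc 0 T, MemLp (w t) 2 μ) {n N a : ℕ} (hN : 0 < N) (ha : a + N ≤ n)
    (h0 : ∀ j ∈ Finset.Icc 1 n, ∫ ω, w (sampleTime T n j) ω ∂μ = 0)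
    (hcov : ∀ j ∈ Finset.Icc 1 n, ∀ k ∈ Finset.Icc 1 n, j ≠ k →
      cov[w (sampleTime T n j), w (sampleTime T n k); μ] = 0) (ρ : ℝ → ℝ)
    (P : ℕ → ℝ[X]) (d : ℕ) :
    ∫ ω, derivEstimate T n N ρ P (fun j => w (sampleTime T n j) ω) a d ^ 2 ∂μ =
      varConst μ T n N ρ P w a d * ((n : ℝ) ^ (2 * d) / (N : ℝ) ^ (2 * d + 1)) := by
  have hle : ∀ j ∈ Finset.Icc 1 N, a + j ∈ Finset.Icc 1 n := by
    intro j hj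
    rw [Finset.mem_Icc] at hj ⊢
    omega
  have hN' : (N : ℝ) ≠ 0 := by exact_mod_cast hN.ne'
  simp only [derivEstimate, mul_pow]
  rw [integral_const_mul, integral_sq_sum_of_uncorrelated
    (fun j : ℕ => ρ ((j : ℝ) / N) * (P d).eval ((j : ℝ) / N))
    (fun j hj => hw _ (sampleTime_mem_Icc hT.le (Finset.mem_Icc.1 (hle j hj)).2))
    (fun j hj => h0 _ (hle j hj))
    (fun j hj k hk hjk => hcov _ (hle j hj) _ (hle k hk) (by omega))]
  simp only [varConst, noiseConst, mul_pow]
  set V := ∑ j ∈ Finset.Icc 1 N, ρ ((j : ℝ) / N) ^ 2 * (P d).eval ((j : ℝ) / N) ^ 2 *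
    Var[w (sampleTime T n (a + j)); μ]
  rw [div_pow, div_pow, mul_pow, mul_pow, mul_pow, mul_pow, ← pow_mul, ← pow_mul, ← pow_mul,
    mul_comm d 2, show (d + 1) * 2 = (2 * d + 1) + 1 by ring, pow_succ (N : ℝ) (2 * d + 1)]
  field_simp

theorem integral_const_add_sq {Ω : Type*} [MeasurableSpace Ω] {μ : Measure Ω}
    [IsProbabilityMeasure μ] {W : Ω → ℝ} (hW : MemLp W 2 μ) (h0 : ∫ ω, W ω ∂μ = 0) (b : ℝ) :
    ∫ ω, (b + W ω) ^ 2 ∂μ = b ^ 2 + ∫ ω, W ω ^ 2 ∂μ := by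
  have hexp : ∀ ω, (b + W ω) ^ 2 = (b ^ 2 + 2 * b * W ω) + W ω ^ 2 := fun ω => by ring
  have hi1 := (hW.integrable one_le_two).const_mul (2 * b)
  have hi2 : Integrable (fun ω => b ^ 2 + 2 * b * W ω) μ := (integrable_const _).add hi1
  simp only [hexp]
  rw [integral_add hi2 hW.integrable_sq, integral_add (integrable_const _) hi1,
    integral_const_mul (2 * b), h0]
  simp

theorem varConst_nonneg {Ω : Type*} [MeasurableSpace Ω] (μ : Measure Ω) (T : ℝ) (n N : ℕ)
    (ρ : ℝ → ℝ) (P : ℕ → ℝ[X]) (w : ℝ → Ω → ℝ) (a d : ℕ) : 0 ≤ varConst μ T n N ρ P w a d := by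
  unfold varConst noiseConst
  refine mul_nonneg (sq_nonneg _) (mul_nonneg (by positivity) (Finset.sum_nonneg fun j _ => ?_))
  exact mul_nonneg (by positivity) (variance_nonneg _ _)

theorem memLp_derivEstimate_observation {Ω : Type*} [MeasurableSpace Ω] {μ : Measure Ω}
    [IsFiniteMeasure μ] {T : ℝ} (hT : 0 ≤ T) (y : ℝ → ℝ) {w : ℝ → Ω → ℝ}
    (hw : ∀ t ∈ Set.Icc 0 T, MemLp (w t) 2 μ) {n N a : ℕ} (ha : a + N ≤ n) (ρ : ℝ → ℝ)
    (P : ℕ → ℝ[X]) (d : ℕ) :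
    MemLp (fun ω => derivEstimate T n N ρ P (observation T n y w ω) a d) 2 μ := by
  simp only [derivEstimate_observation]
  exact (memLp_const (derivEstimate T n N ρ P (fun j => y (sampleTime T n j)) a d)).add
    (memLp_derivEstimate_noise hT hw ha ρ P d)

/-- Squared bias plus variance, for the estimate of the `d`-th derivative in one window. -/
theorem integral_derivEstimate_sub_sq_le {Ω : Type*} [MeasurableSpace Ω] {μ : Measure Ω}
    [IsProbabilityMeasure μ] {n N a d : ℕ} {T : ℝ} (hT : 0 < T) {y : ℝ → ℝ}
    (hy : ∀ k ≤ d, DifferentiableOn ℝ (timeDeriv T y k) (Set.Icc 0 T))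
    {w : ℝ → Ω → ℝ} (hw : ∀ t ∈ Set.Icc 0 T, MemLp (w t) 2 μ)
    {ρ : ℝ → ℝ} (hρ : ∀ t ∈ Set.Icc (0 : ℝ) 1, 0 < ρ t)
    (hd : d < N) {P : ℕ → ℝ[X]} (hP : IsOrthogonalFamily ρ N P) (ha : a + N ≤ n)
    (h0 : ∀ j ∈ Finset.Icc 1 n, ∫ ω, w (sampleTime T n j) ω ∂μ = 0)
    (hcov : ∀ j ∈ Finset.Icc 1 n, ∀ k ∈ Finset.Icc 1 n, j ≠ k →
      cov[w (sampleTime T n j), w (sampleTime T n k); μ] = 0)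
    (hb : BddAbove ((fun t => |timeDeriv T y (d + 1) t|) '' Set.Icc 0 T)) :
    ∫ ω, (derivEstimate T n N ρ P (observation T n y w ω) a d -
        timeDeriv T y d (sampleTime T n a)) ^ 2 ∂μ ≤
      biasConst T n N ρ P y a d * ((N : ℝ) ^ 2 / (n : ℝ) ^ 2) +
        varConst μ T n N ρ P w a d * ((n : ℝ) ^ (2 * d) / (N : ℝ) ^ (2 * d + 1)) := by
  have hbias := abs_derivEstimate_sub_le hT hρ hP ha hd hy hb
  have hexp : ∀ ω, derivEstimate T n N ρ P (observation T n y w ω) a d -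
      timeDeriv T y d (sampleTime T n a) =
      (derivEstimate T n N ρ P (fun j => y (sampleTime T n j)) a d -
        timeDeriv T y d (sampleTime T n a)) +
      derivEstimate T n N ρ P (fun j => w (sampleTime T n j) ω) a d := by
    intro ω; rw [derivEstimate_observation]; ring
  simp only [hexp]
  rw [integral_const_add_sq (memLp_derivEstimate_noise hT.le hw ha ρ P d)
    (integral_derivEstimate_noise hT.le hw ha h0 ρ P d),
    integral_derivEstimate_noise_sq hT hw (by omega) ha h0 hcov]
  refine add_le_add ?_ le_rfl
  rw [← sq_abs]
  refine (pow_le_pow_left₀ (abs_nonneg _) hbias 2).trans_eq ?_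
  rw [biasConst, mul_pow, mul_pow, div_pow (filterG ρ N P d), sq_abs, div_pow (N : ℝ),
    div_pow (filterG ρ N P d)]

theorem norm_sq_jetEstimate_sub (T : ℝ) (n N m : ℕ) (ρ : ℝ → ℝ) (P : ℕ → ℝ[X]) (y : ℝ → ℝ)
    (z : ℕ → ℝ) (a : ℕ) (t : ℝ) :
    ‖jetEstimate T n N m ρ P z a - jet T y (m + 1) t‖ ^ 2 =
      ∑ d ∈ Finset.range (m + 1), (derivEstimate T n N ρ P z a d - timeDeriv T y d t) ^ 2 := by
  rw [EuclideanSpace.norm_sq_eq, ← Fin.sum_univ_eq_sum_range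
    (fun d => (derivEstimate T n N ρ P z a d - timeDeriv T y d t) ^ 2)]
  refine Finset.sum_congr rfl fun d _ => ?_
  rw [Real.norm_eq_abs, sq_abs]
  rfl

theorem integral_sum_norm_sq_jetEstimate_sub_le {Ω : Type*} [MeasurableSpace Ω] {μ : Measure Ω}
    [IsProbabilityMeasure μ] {m n n' N : ℕ} {T : ℝ} (hT : 0 < T) {y : ℝ → ℝ}
    (hy : ∀ k ≤ m, DifferentiableOn ℝ (timeDeriv T y k) (Set.Icc 0 T))
    {w : ℝ → Ω → ℝ} (hw : ∀ t ∈ Set.Icc 0 T, MemLp (w t) 2 μ)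
    {ρ : ℝ → ℝ} (hρ : ∀ t ∈ Set.Icc (0 : ℝ) 1, 0 < ρ t)
    (hN : m + 1 ≤ N) {P : ℕ → ℝ[X]} (hP : IsOrthogonalFamily ρ N P)
    {s : Fin n' → ℕ} (hs : ∀ i, s i + N ≤ n)
    (h0 : ∀ j ∈ Finset.Icc 1 n, ∫ ω, w (sampleTime T n j) ω ∂μ = 0)
    (hcov : ∀ j ∈ Finset.Icc 1 n, ∀ k ∈ Finset.Icc 1 n, j ≠ k →
      cov[w (sampleTime T n j), w (sampleTime T n k); μ] = 0)
    (hb : BddAbove ((fun t => |timeDeriv T y (m + 1) t|) '' Set.Icc 0 T)) :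
    ∫ ω, ∑ i, ‖jetEstimate T n N m ρ P (observation T n y w ω) (s i) -
        jet T y (m + 1) (sampleTime T n (s i))‖ ^ 2 ∂μ ≤
      totalBiasConst T n N m ρ P y s * ((N : ℝ) ^ 2 / (n : ℝ) ^ 2) +
        totalVarConst μ T n N m ρ P w s * ((n : ℝ) ^ (2 * m) / (N : ℝ) ^ (2 * m + 1)) := by
  have hN0 : (0 : ℝ) < N := by exact_mod_cast (by omega : 0 < N)
  have hb' : ∀ d ≤ m, BddAbove ((fun t => |timeDeriv T y (d + 1) t|) '' Set.Icc 0 T) := by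
    intro d hd
    rcases hd.eq_or_lt with rfl | hlt
    · exact hb
    · exact (isCompact_Icc.image_of_continuousOn (hy (d + 1) hlt).continuousOn.abs).bddAbove
  have hint : ∀ i d, Integrable (fun ω => (derivEstimate T n N ρ P (observation T n y w ω) (s i) d -
      timeDeriv T y d (sampleTime T n (s i))) ^ 2) μ := fun i d =>
    ((memLp_derivEstimate_observation hT.le y hw (hs i) ρ P d).sub
      (memLp_const (timeDeriv T y d (sampleTime T n (s i))))).integrable_sq
  have hone : ∀ i, ∀ d ∈ Finset.range (m + 1),
      ∫ ω, (derivEstimate T n N ρ P (observation T n y w ω) (s i) d -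
        timeDeriv T y d (sampleTime T n (s i))) ^ 2 ∂μ ≤
      biasConst T n N ρ P y (s i) d * ((N : ℝ) ^ 2 / (n : ℝ) ^ 2) +
      varConst μ T n N ρ P w (s i) d * ((n : ℝ) ^ (2 * m) / (N : ℝ) ^ (2 * m + 1)) := by
    intro i d hd
    have hdm : d ≤ m := Nat.lt_succ_iff.1 (Finset.mem_range.1 hd)
    have hNn : (N : ℝ) ≤ n := by exact_mod_cast (Nat.le_add_left N (s i)).trans (hs i)
    refine (integral_derivEstimate_sub_sq_le hT (fun k hk => hy k (hk.trans hdm)) hw hρ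
      (by omega) hP (hs i) h0 hcov (hb' d hdm)).trans (add_le_add le_rfl ?_)
    refine mul_le_mul_of_nonneg_left ?_ (varConst_nonneg μ T n N ρ P w (s i) d)
    have h1 : ∀ k : ℕ, (n : ℝ) ^ (2 * k) / (N : ℝ) ^ (2 * k + 1) =
        ((n : ℝ) / N) ^ (2 * k) / N := by
      intro k; rw [div_pow, pow_succ]; field_simp
    -- the variance bound increases with the order `d`, as `N ≤ n`
    rw [h1, h1]
    exact div_le_div_of_nonneg_right
      (pow_le_pow_right₀ ((one_le_div hN0).2 hNn) (by omega)) hN0.le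
  simp only [norm_sq_jetEstimate_sub]
  rw [integral_finsetSum _ fun i _ => integrable_finsetSum _ fun d _ => hint i d]
  have hsplit : ∀ i, ∫ ω, ∑ d ∈ Finset.range (m + 1),
      (derivEstimate T n N ρ P (observation T n y w ω) (s i) d -
        timeDeriv T y d (sampleTime T n (s i))) ^ 2 ∂μ = ∑ d ∈ Finset.range (m + 1),
      ∫ ω, (derivEstimate T n N ρ P (observation T n y w ω) (s i) d -
        timeDeriv T y d (sampleTime T n (s i))) ^ 2 ∂μ := fun i =>
    integral_finsetSum _ fun d _ => hint i d
  simp only [hsplit]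
  refine (Finset.sum_le_sum fun i _ => Finset.sum_le_sum (hone i)).trans_eq ?_
  simp only [Finset.sum_add_distrib, ← Finset.sum_mul, totalBiasConst, totalVarConst]

/-! ### The optimised window length -/

/-- The numerical inequality behind the constant `2 (2m+1)^{1/(2m+3)}`. -/
theorem optimalWindow_numeric (m : ℕ) :
    ((2 * m + 3) / (2 * (2 * m + 1)) : ℝ) ^ (2 * m + 3) ≤ 4 / (2 * m + 1) := by
  rcases m.eq_zero_or_pos with rfl | hm
  · norm_num
  have hm1 : (1 : ℝ) ≤ m := by exact_mod_cast hm
  set t : ℝ := 2 * (2 * m + 1) / (2 * m + 3) with ht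
  have ht0 : 0 < t := by positivity
  -- Bernoulli's inequality for `t = 1 + (2m-1)/(2m+3)`
  have hbern : (2 * m : ℝ) ≤ t ^ (2 * m + 3) := by
    have h := one_add_mul_sub_le_pow (by linarith : -1 ≤ t) (2 * m + 3)
    have e : (1 : ℝ) + ((2 * m + 3 : ℕ) : ℝ) * (t - 1) = 2 * m := by
      rw [ht]; push_cast; field_simp; ring
    rwa [e] at h
  have hinv : ((2 * m + 3) / (2 * (2 * m + 1)) : ℝ) = t⁻¹ := by rw [ht, inv_div]
  rw [hinv, inv_pow, inv_eq_one_div, div_le_div_iff₀ (by positivity) (by positivity)]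
  linarith

/-- The window length `N` balances squared bias and variance. -/
theorem bias_add_variance_le_of_optimalWindow {m n n' N : ℕ} (hn : 0 < n) (hn' : 0 < n')
    (hN : 0 < N) {A B : ℝ} (hA : 0 ≤ A) (hB : 0 ≤ B) (hNopt : (N : ℝ) = optimalWindow m n A B) :
    A * ((N : ℝ) ^ 2 / (n : ℝ) ^ 2) + B * ((n : ℝ) ^ (2 * m) / (N : ℝ) ^ (2 * m + 1)) ≤
      epsilonN m n' A B * n' * (n : ℝ) ^ (-(2 / (2 * m + 3)) : ℝ) := by
  have hn0 : (0 : ℝ) < n := by exact_mod_cast hn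
  have hn'0 : (0 : ℝ) < n' := by exact_mod_cast hn'
  have hN0 : (0 : ℝ) < N := by exact_mod_cast hN
  set K := (2 * m + 1) * B / (2 * A) with hK
  set κ := K ^ (1 / (2 * m + 3) : ℝ) with hκ
  set r := (n : ℝ) ^ (1 / (2 * m + 3) : ℝ) with hr
  -- if `A = 0` or `B = 0`, then `K = 0` (in the first case since `x / 0 = 0`), so `N = 0`
  have hK0 : K ≠ 0 := by
    intro h
    rw [optimalWindow, ← hK, h, Real.zero_rpow (by positivity), zero_mul] at hNopt
    exact hN0.ne' hNopt
  have hA0 : 0 < A := hA.lt_of_ne' fun h => hK0 (by rw [hK, h]; simp)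
  have hKpos : 0 < K := lt_of_le_of_ne (by positivity) (Ne.symm hK0)
  have hκ0 : 0 < κ := by positivity
  have hr0 : 0 < r := by positivity
  have hroot : ∀ t : ℝ, 0 ≤ t → (t ^ (1 / (2 * m + 3) : ℝ)) ^ (2 * m + 3) = t := by
    intro t ht
    rw [← Real.rpow_natCast, ← Real.rpow_mul ht]
    push_cast
    rw [one_div_mul_cancel (by positivity), Real.rpow_one]
  have hnr : (n : ℝ) = r ^ (2 * m + 3) := (hroot n hn0.le).symm
  have hKκ : K = κ ^ (2 * m + 3) := (hroot K hKpos.le).symm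
  have hBκ : B = 2 * A / (2 * m + 1) * κ ^ (2 * m + 3) := by
    rw [← hKκ, hK]; field_simp
  have hNr : (N : ℝ) = κ * r ^ (2 * m + 2) := by
    rw [hNopt, optimalWindow, ← hK, ← hκ, hr, ← Real.rpow_natCast (_ ^ _), ← Real.rpow_mul hn0.le]
    congr 2; push_cast; ring
  have hlast : (n : ℝ) ^ (-(2 / (2 * m + 3)) : ℝ) = 1 / r ^ 2 := by
    rw [Real.rpow_neg hn0.le, one_div, hr, ← Real.rpow_natCast (_ ^ _), ← Real.rpow_mul hn0.le]
    congr 2; push_cast; ring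
  have hlhs : A * ((N : ℝ) ^ 2 / (n : ℝ) ^ 2) +
      B * ((n : ℝ) ^ (2 * m) / (N : ℝ) ^ (2 * m + 1)) =
      (2 * m + 3) / (2 * m + 1) * (A * κ ^ 2 / r ^ 2) := by
    have e1 : (N : ℝ) ^ 2 / (n : ℝ) ^ 2 = κ ^ 2 / r ^ 2 := by
      rw [hNr, hnr, div_eq_div_iff (by positivity) (by positivity)]; ring
    have e2 : κ ^ (2 * m + 3) * ((n : ℝ) ^ (2 * m) / (N : ℝ) ^ (2 * m + 1)) = κ ^ 2 / r ^ 2 := by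
      rw [hNr, hnr, mul_div_assoc', div_eq_div_iff (by positivity) (by positivity)]; ring
    rw [e1, hBκ, mul_assoc (2 * A / _), e2]
    field_simp
    ring
  have hc : (2 * m + 3) / (2 * (2 * m + 1)) ≤ (4 / (2 * m + 1) : ℝ) ^ (1 / (2 * m + 3) : ℝ) := by
    refine le_of_pow_le_pow_left₀ (by omega : 2 * m + 3 ≠ 0) (by positivity) ?_
    rw [hroot _ (by positivity)]
    exact optimalWindow_numeric m
  have hrhs : epsilonN m n' A B * n' =
      2 * (4 / (2 * m + 1) : ℝ) ^ (1 / (2 * m + 3) : ℝ) * (A * κ ^ 2) := by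
    have e1 : (κ ^ (2 * m + 3)) ^ (2 / (2 * m + 3) : ℝ) = κ ^ 2 := by
      rw [← Real.rpow_natCast, ← Real.rpow_mul hκ0.le, ← Real.rpow_natCast]
      congr 1; push_cast; field_simp
    have e2 : A ^ ((2 * m + 1) / (2 * m + 3) : ℝ) * A ^ (2 / (2 * m + 3) : ℝ) = A := by
      rw [← Real.rpow_add hA0, ← add_div]
      have : ((2 * m + 1 + 2) / (2 * m + 3) : ℝ) = 1 := by
        rw [div_eq_one_iff_eq (by positivity)]; ring
      rw [this, Real.rpow_one]
    have e3 : (2 * m + 1 : ℝ) ^ (1 / (2 * m + 3) : ℝ) * (2 / (2 * m + 1)) ^ (2 / (2 * m + 3) : ℝ) =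
        (4 / (2 * m + 1) : ℝ) ^ (1 / (2 * m + 3) : ℝ) := by
      have : (2 / (2 * m + 1) : ℝ) ^ (2 / (2 * m + 3) : ℝ) =
          ((2 / (2 * m + 1)) ^ 2) ^ (1 / (2 * m + 3) : ℝ) := by
        rw [← Real.rpow_natCast _ 2, ← Real.rpow_mul (by positivity)]
        congr 1; push_cast; ring
      rw [this, ← Real.mul_rpow (by positivity) (by positivity)]
      congr 1; field_simp; norm_num
    have e4 : B ^ (2 / (2 * m + 3) : ℝ) =
        A ^ (2 / (2 * m + 3) : ℝ) * (2 / (2 * m + 1)) ^ (2 / (2 * m + 3) : ℝ) * κ ^ 2 := by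
      rw [hBκ, Real.mul_rpow (by positivity) (by positivity), e1,
        ← Real.mul_rpow hA0.le (by positivity)]
      congr 2; ring
    rw [epsilonN, div_mul_cancel₀ _ hn'0.ne', e4, ← e3]
    calc _ = 2 * ((2 * m + 1 : ℝ) ^ (1 / (2 * m + 3) : ℝ) *
          (2 / (2 * m + 1)) ^ (2 / (2 * m + 3) : ℝ)) *
          ((A ^ ((2 * m + 1) / (2 * m + 3) : ℝ) * A ^ (2 / (2 * m + 3) : ℝ)) * κ ^ 2) := by ring
      _ = _ := by rw [e2]
  rw [hlhs, hrhs, hlast]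
  have h1 : (2 * m + 3) / (2 * m + 1) = 2 * ((2 * m + 3) / (2 * (2 * m + 1)) : ℝ) := by field_simp
  rw [h1, mul_one_div, mul_div_assoc _ (A * κ ^ 2)]
  exact mul_le_mul_of_nonneg_right (mul_le_mul_of_nonneg_left hc zero_le_two) (by positivity)

theorem totalBiasConst_nonneg {n' : ℕ} (T : ℝ) (n N m : ℕ) (ρ : ℝ → ℝ) (P : ℕ → ℝ[X]) (y : ℝ → ℝ)
    (s : Fin n' → ℕ) : 0 ≤ totalBiasConst T n N m ρ P y s :=
  Finset.sum_nonneg fun _ _ => Finset.sum_nonneg fun _ _ => mul_nonneg (sq_nonneg _) (sq_nonneg _)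

theorem totalVarConst_nonneg {Ω : Type*} [MeasurableSpace Ω] (μ : Measure Ω) {n' : ℕ} (T : ℝ)
    (n N m : ℕ) (ρ : ℝ → ℝ) (P : ℕ → ℝ[X]) (w : ℝ → Ω → ℝ) (s : Fin n' → ℕ) :
    0 ≤ totalVarConst μ T n N m ρ P w s :=
  Finset.sum_nonneg fun _ _ => Finset.sum_nonneg fun _ _ => varConst_nonneg μ T n N ρ P w _ _

theorem pos_of_sigmaMin_pos {k p : ℕ} {A : Matrix (Fin k) (Fin p) ℝ} (h : 0 < sigmaMin A) :
    0 < k := by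
  rw [sigmaMin, LinearMap.singularValues_pos_iff_lt_finrank_range] at h
  have := Submodule.finrank_le (LinearMap.range (Matrix.toEuclideanLin A))
  rw [finrank_euclideanSpace_fin] at this
  omega

theorem memLp_jetEstimate {Ω : Type*} [MeasurableSpace Ω] {μ : Measure Ω}
    [IsFiniteMeasure μ] {T : ℝ} (hT : 0 ≤ T) (y : ℝ → ℝ) {w : ℝ → Ω → ℝ}
    (hw : ∀ t ∈ Set.Icc 0 T, MemLp (w t) 2 μ) {n N a : ℕ} (ha : a + N ≤ n) (ρ : ℝ → ℝ)
    (P : ℕ → ℝ[X]) (m : ℕ) :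
    MemLp (fun ω => jetEstimate T n N m ρ P (observation T n y w ω) a) 2 μ :=
  MemLp.of_eval_piLp fun d => memLp_derivEstimate_observation hT y hw ha ρ P d

end HyperjerkId

theorem mainTheorem4 {Ω : Type*} [MeasurableSpace Ω] (μ : Measure Ω) [IsProbabilityMeasure μ]
    (m p n n' N : ℕ) (T : ℝ) (hT : 0 < T)
    -- the system: `φ` is Hölder, `y` is `m + 1` times differentiable and solves the ODE
    (φ : EuclideanSpace ℝ (Fin m) → EuclideanSpace ℝ (Fin p))
    (α C : ℝ≥0) (hα₀ : 0 < α) (hα₁ : α ≤ 1) (hφ : HolderWith C α φ)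
    (θ : EuclideanSpace ℝ (Fin p)) (y : ℝ → ℝ)
    (hy : ∀ k ≤ m, DifferentiableOn ℝ (timeDeriv T y k) (Set.Icc 0 T))
    (hode : ∀ t ∈ Set.Icc 0 T, timeDeriv T y m t = inner ℝ θ (φ (jet T y m t)))
    -- the noise is square integrable
    (w : ℝ → Ω → ℝ) (hw : ∀ t ∈ Set.Icc 0 T, MemLp (w t) 2 μ)
    -- the filter and the windows
    (ρ : ℝ → ℝ) (hρ : ∀ t ∈ Set.Icc (0 : ℝ) 1, 0 < ρ t)
    (hN : m + 1 ≤ N) (P : ℕ → ℝ[X]) (hP : IsOrthogonalFamily ρ N P)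
    (s : Fin n' → ℕ) (hs : ∀ i, s i + N ≤ n)
    -- true and estimated augmented states in the windows
    (x : Fin n' → EuclideanSpace ℝ (Fin (m + 1)))
    (hx : ∀ i, x i = jet T y (m + 1) (sampleTime T n (s i)))
    (xhat : Ω → Fin n' → EuclideanSpace ℝ (Fin (m + 1)))
    (hxhat : ∀ ω i, xhat ω i = jetEstimate T n N m ρ P (observation T n y w ω) (s i))
    (A B : ℝ) (hA : A = totalBiasConst T n N m ρ P y s)
    (hB : B = totalVarConst μ T n N m ρ P w s)
    (σ U : ℝ) (hσ : σ = sigmaMin (featureMatrix φ x) / √n') (hU : U = ‖target p x‖ / √n') :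
    -- explicit admissible values of `ε_N`, for centred uncorrelated noise and bounded `y^{(m+1)}`
    ((∀ j ∈ Finset.Icc 1 n, ∫ ω, w (sampleTime T n j) ω ∂μ = 0) →
      (∀ j ∈ Finset.Icc 1 n, ∀ k ∈ Finset.Icc 1 n, j ≠ k →
        cov[w (sampleTime T n j), w (sampleTime T n k); μ] = 0) →
      BddAbove ((fun t => |timeDeriv T y (m + 1) t|) '' Set.Icc 0 T) →
      (∫ ω, ∑ i, ‖xhat ω i - x i‖ ^ 2 ∂μ
        ≤ A * ((N : ℝ) ^ 2 / (n : ℝ) ^ 2) + B * ((n : ℝ) ^ (2 * m) / (N : ℝ) ^ (2 * m + 1))) ∧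
      ((N : ℝ) = optimalWindow m n A B →
        ∫ ω, ∑ i, ‖xhat ω i - x i‖ ^ 2 ∂μ
          ≤ epsilonN m n' A B * n' * (n : ℝ) ^ (-(2 / (2 * m + 3)) : ℝ))) ∧
    -- the first moment of the estimation error
    (∀ ε εm : ℝ,
      ∫ ω, ∑ i, ‖xhat ω i - x i‖ ^ 2 ∂μ ≤ ε * n' * (n : ℝ) ^ (-(2 / (2 * m + 3)) : ℝ) →
      ∫ ω, ∑ i, (xhat ω i (Fin.last m) - x i (Fin.last m)) ^ 2 ∂μ
        ≤ εm * n' * (n : ℝ) ^ (-(2 / (2 * m + 3)) : ℝ) →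
      ∀ l : ℝ, 0 < l → l < sigmaMin (featureMatrix φ x) →
        Integrable (fun ω => ‖ridgeEstimate l φ (xhat ω) - θ‖) μ ∧
        ∫ ω, ‖ridgeEstimate l φ (xhat ω) - θ‖ ∂μ ≤ firstMomentBound m n n' α C ε εm σ U l) := by
  have hxhat' : xhat = fun ω i => jetEstimate T n N m ρ P (observation T n y w ω) (s i) := by
    funext ω i; exact hxhat ω i
  have hx' : x = fun i => jet T y (m + 1) (sampleTime T n (s i)) := funext hx
  refine ⟨fun h0 hcov hb => ?_, fun ε εm hε hεm l hl hlS => ?_⟩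
  · have hmain : ∫ ω, ∑ i, ‖xhat ω i - x i‖ ^ 2 ∂μ
        ≤ A * ((N : ℝ) ^ 2 / (n : ℝ) ^ 2) + B * ((n : ℝ) ^ (2 * m) / (N : ℝ) ^ (2 * m + 1)) := by
      rw [hA, hB, hxhat', hx']
      exact integral_sum_norm_sq_jetEstimate_sub_le hT hy hw hρ hN hP hs h0 hcov hb
    refine ⟨hmain, fun hNopt => ?_⟩
    rcases n'.eq_zero_or_pos with rfl | hn'
    · simp
    · have hn : 0 < n := by have := hs ⟨0, hn'⟩; omega
      refine hmain.trans (bias_add_variance_le_of_optimalWindow hn hn' (by omega) ?_ ?_ hNopt)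
      · rw [hA]; exact totalBiasConst_nonneg T n N m ρ P y s
      · rw [hB]; exact totalVarConst_nonneg μ T n N m ρ P w s
  · have hn' : 0 < n' := pos_of_sigmaMin_pos (hl.trans hlS)
    have hn : 0 < n := by have := hs ⟨0, hn'⟩; omega
    have hlin : ∀ i, x i (Fin.last m) = inner ℝ θ (φ (firstEntries (x i))) := by
      intro i
      rw [hx i]
      exact hode _ (sampleTime_mem_Icc hT.le ((Nat.le_add_right _ _).trans (hs i)))
    have hmem : ∀ i, MemLp (fun ω => xhat ω i) 2 μ := by
      intro i
      rw [hxhat']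
      exact memLp_jetEstimate hT.le y hw (hs i) ρ P m
    rw [hσ, hU]
    exact integral_norm_ridgeEstimate_sub_le hn hn' hα₀ hα₁ hφ hlin hmem hε hεm hl hlS
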